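/- Fix an integer $p\ge 3$. For $\beta\ge 0$, $h\in\mathbb R$ and $N\ge 1$, the $p$-tensor Curie–Weiss model is the probability law on $\{-1,1\}^N$ $$\mathbb P_{\beta,h,p}(\boldsymbol x)=\frac{1}{2^N Z_N(\beta,h,p)}\exp\Big\{\frac{\beta}{N^{p-1}}\sum_{1\le i_1,\dots,i_p\le N}x_{i_1}\cdots x_{i_p}+h\sum_{i=1}^N x_i\Big\},$$ where $Z_N(\beta,h,p)$ is the normalizing constant. Put $$H(x)=H_{\beta,h,p}(x)=\beta x^p+hx-\tfrac12\{(1+x)\log(1+x)+(1-x)\log(1-x)\},\qquad x\in[-1,1].$$ The point $(\beta,h)$ is called $p$-special if $H_{\beta,h,p}$ has a unique global maximizer $m_*$ on $[-1,1]$, $m_*\in(-1,1)$, and $H_{\beta,h,p}''(m_*)=0$. **Theorem.** Let $p\ge 3$ and let $(\beta,h)\in[0,\infty)\times\mathbb R$ be $p$-special, with $m_*$ the unique maximizer of $H=H_{\beta,h,p}$. Assume that $\beta$ is known, let $\boldsymbol X\sim\mathbb P_{\beta,h,p}$ on $\{-1,1\}^N$, and let $\hat h_N$ be the maximum likelihood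 estimate of $h$, i.e. a maximizer over $h'\in\mathbb R$ of $\mathbb P_{\beta,h',p}(\boldsymbol X)$ (with an arbitrary real value at samples for which no maximizer in $\mathbb R$ exists). For $t\in\mathbb R$ let $F_{0,t}$ be the probability law on $\mathbb R$ with density $$\frac{\mathrm dF_{0,t}(x)}{\mathrm dx}\ \propto\ \exp\Big(\frac{H^{(4)}(m_*)}{24}x^4+t\,x\Big);$$ this density is normalizable and $F_{0,t}$ has a finite mean. Then, as $N\to\infty$, $$N^{3/4}(\hat h_N-h)\xrightarrow{D}G_1,$$ where $G_1$ is the probability law on $\mathbb R$ with distribution function $$G_1(t)=F_{0,0}\Big(\int_{-\infty}^{\infty}u\,\mathrm dF_{0,t}(u)\Big),\qquad t\in\mathbb R,$$ $F_{0,0}(\cdot)$ denoting the distribution function of the law $F_{0,0}$. The law $G_1$ is not Gaussian (nor a point mass). -/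

import Mathlib

open MeasureTheory ProbabilityTheory Filter Set

noncomputable section

namespace CurieWeiss

/-- Spin configurations `X = (X_1, …, X_N) ∈ {-1, 1}^N`; the elements of `ℤˣ` are exactly `1, -1`. -/
abbrev Config (N : ℕ) : Type := Fin N → ℤˣ

/-- Every set of configurations is measurable. -/
instance instDiscreteMeasurableSpaceConfig (N : ℕ) : DiscreteMeasurableSpace (Config N) := by
  have h1 : MeasurableSingletonClass ℤˣ := by
    refine ⟨fun u => ⟨{(u : ℤ)}, MeasurableSet.singleton _, ?_⟩⟩
    ext v
    simp [Units.ext_iff]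
  exact MeasurableSingletonClass.toDiscreteMeasurableSpace

/-- The spin `X_i` as a real number. -/
def spin {N : ℕ} (x : Config N) (i : Fin N) : ℝ := ((x i : ℤ) : ℝ)

/-- The exponent
`β / N^(p-1) * ∑_{1 ≤ i_1, …, i_p ≤ N} X_{i_1} ⋯ X_{i_p} + h * ∑_i X_i`. -/
def energy (p N : ℕ) (β h : ℝ) (x : Config N) : ℝ :=
  β / (N : ℝ) ^ (p - 1) * (∑ i : Fin p → Fin N, ∏ j : Fin p, spin x (i j))
    + h * ∑ i : Fin N, spin x i

/-- The partition function `Z_N(β, h, p)`. -/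
def partitionFn (p N : ℕ) (β h : ℝ) : ℝ :=
  1 / 2 ^ N * ∑ x : Config N, Real.exp (energy p N β h x)

/-- The probability mass function of the `p`-tensor Curie-Weiss model; as a function of the
parameters at a fixed `x`, it is the likelihood function. -/
def pmf (p N : ℕ) (β h : ℝ) (x : Config N) : ℝ :=
  Real.exp (energy p N β h x) / (2 ^ N * partitionFn p N β h)

/-- The law `P_{β,h,p}` on `{-1, 1}^N`. -/
def law (p N : ℕ) (β h : ℝ) : Measure (Config N) :=
  ∑ x : Config N, ENNReal.ofReal (pmf p N β h x) • Measure.dirac x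

theorem sum_exp_energy_pos (p N : ℕ) (β h : ℝ) :
    0 < ∑ x : Config N, Real.exp (energy p N β h x) :=
  Finset.sum_pos (fun _ _ => Real.exp_pos _) Finset.univ_nonempty

theorem two_pow_mul_partitionFn (p N : ℕ) (β h : ℝ) :
    2 ^ N * partitionFn p N β h = ∑ x : Config N, Real.exp (energy p N β h x) := by
  unfold partitionFn
  field_simp

theorem pmf_nonneg (p N : ℕ) (β h : ℝ) (x : Config N) : 0 ≤ pmf p N β h x := by
  unfold pmf
  rw [two_pow_mul_partitionFn]
  exact div_nonneg (Real.exp_pos _).le (sum_exp_energy_pos p N β h).le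

theorem sum_pmf (p N : ℕ) (β h : ℝ) : ∑ x : Config N, pmf p N β h x = 1 := by
  unfold pmf
  rw [two_pow_mul_partitionFn, ← Finset.sum_div]
  exact div_self (sum_exp_energy_pos p N β h).ne'

instance instIsProbabilityMeasureLaw (p N : ℕ) (β h : ℝ) :
    IsProbabilityMeasure (law p N β h) := by
  constructor
  simp only [law, Measure.finsetSum_apply, Measure.smul_apply, measure_univ, smul_eq_mul, mul_one]
  rw [← ENNReal.ofReal_sum_of_nonneg (fun x _ => pmf_nonneg p N β h x), sum_pmf,
    ENNReal.ofReal_one]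

/-- The binary entropy function `I` (with `0 log 0 = 0`). -/
def entropyFn (x : ℝ) : ℝ :=
  1 / 2 * ((1 + x) * Real.log (1 + x) + (1 - x) * Real.log (1 - x))

/-- The function `H_{β,h,p}(x) = β x^p + h x - I(x)`; only its values on `[-1, 1]` matter. -/
def H (p : ℕ) (β h : ℝ) (x : ℝ) : ℝ := β * x ^ p + h * x - entropyFn x

/-- `m ∈ (-1, 1)` is the unique global maximizer of `H_{β,h,p}` over `[-1, 1]`. -/
def IsUniqueGlobalMax (p : ℕ) (β h m : ℝ) : Prop :=
  m ∈ Ioo (-1 : ℝ) 1 ∧ ∀ x ∈ Icc (-1 : ℝ) 1, x ≠ m → H p β h x < H p β h m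

/-- The point `(β, h)` is `p`-special. -/
def IsSpecial (p : ℕ) (β h : ℝ) : Prop :=
  ∃ m : ℝ, IsUniqueGlobalMax p β h m ∧ iteratedDeriv 2 (H p β h) m = 0

/-- `est` is a maximum likelihood estimator of `h` based on one sample `x ∈ {-1, 1}^N`, for
known `β`: whenever the likelihood `h' ↦ P_{β,h',p}(x)` has a maximizer over `ℝ`, the value
`est x` is such a maximizer. At samples without a real maximizer (all spins equal, where the
supremum is only approached as `h' → ±∞`) the value is unrestricted. -/
def IsFieldMLE (p N : ℕ) (β : ℝ) (est : Config N → ℝ) : Prop :=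
  ∀ x : Config N, (∃ θ : ℝ, IsMaxOn (fun h' => pmf p N β h' x) univ θ) →
    IsMaxOn (fun h' => pmf p N β h' x) univ (est x)

/-- The unnormalized density
`exp (H^(4)(m) / 24 * x^4 + (β' p m^(p-1) + h') x)` of `F_{β',h'}`. -/
def quarticWeight (p : ℕ) (β h m β' h' : ℝ) (x : ℝ) : ℝ :=
  Real.exp (iteratedDeriv 4 (H p β h) m / 24 * x ^ 4 + (β' * p * m ^ (p - 1) + h') * x)

/-- The quartic-exponential law `F_{β',h'}`: the measure on `ℝ` whose Lebesgue density is the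
normalized `quarticWeight`. -/
def quarticLaw (p : ℕ) (β h m β' h' : ℝ) : Measure ℝ :=
  volume.withDensity fun x =>
    ENNReal.ofReal (quarticWeight p β h m β' h' x / ∫ y, quarticWeight p β h m β' h' y)

end CurieWeiss

end

noncomputable section
namespace CurieWeiss
open Topology

/-! For known β the model is an exponential family in the field: the score is the magnetization
minus its mean `meanMag`, and `meanMag` is strictly increasing in the field. So, unless all spins
are equal, the estimate is at most θ exactly when the observed magnetization is at most `meanMag` at
θ (`IsFieldMLE.le_iff`). For θ = h + t N^(-3/4) and W = N^(1/4) (mag/N - m) this event reads W ≤ E_θ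
W (`IsFieldMLE.scaled_le_iff`), and passing from h to θ tilts the law of W by exp(tW)
(`sum_pmf_tilt_mul_eq`). It remains to find the limit law of W under h, together with its
exponential moments.

At a special point the second derivative of H at m vanishes, hence so does the third, and the fourth
is negative. Stirling's formula turns the weight of a magnetization level x into a prefactor times
exp(N (H(x) - H(m))), which is close to exp(q w^4) with q = H''''(m)/24 and w = N^(1/4) (x - m). The
values of w form a lattice of mesh 2 N^(-3/4), so expectations are quotients of Riemann sums, and a
bound of the form exp(-c w^4) allows test functions of exponential growth (`tendsto_sum_pmf_mul`).
Thus E_θ W tends to the mean of F_{0,t}, and the distribution function of W converges along these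
moving arguments (`tendsto_law_fluct_le`).

The mean of F_{0,t} is the derivative at t of the cumulant generating function of F_{0,0}; it is
continuous, monotone and unbounded in both directions, so G_1 is a distribution function. It grows
at most like t^(1/3), so the upper tail of G_1 is at least of order exp(-C t^(4/3)), too heavy for a
Gaussian law or a point mass (`ne_gaussianReal_of_cdf_eq`). -/

/-! ### Derivatives and Taylor expansion of H -/

theorem one_add_pos_of_mem {x : ℝ} (hx : x ∈ Ioo (-1 : ℝ) 1) : 0 < 1 + x := by linarith [hx.1]

theorem one_sub_pos_of_mem {x : ℝ} (hx : x ∈ Ioo (-1 : ℝ) 1) : 0 < 1 - x := by linarith [hx.2]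

theorem one_sub_sq_pos_of_mem {x : ℝ} (hx : x ∈ Ioo (-1 : ℝ) 1) : 0 < 1 - x ^ 2 := by
  nlinarith [one_add_pos_of_mem hx, one_sub_pos_of_mem hx]

theorem continuous_H (p : ℕ) (β h : ℝ) : Continuous (H p β h) := by
  have h1 : Continuous fun x : ℝ => (1 + x) * Real.log (1 + x) :=
    Real.continuous_mul_log.comp (continuous_const.add continuous_id)
  have h2 : Continuous fun x : ℝ => (1 - x) * Real.log (1 - x) :=
    Real.continuous_mul_log.comp (continuous_const.sub continuous_id)
  unfold H entropyFn
  fun_prop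

theorem contDiffOn_H (p : ℕ) (β h : ℝ) (n : WithTop ℕ∞) :
    ContDiffOn ℝ n (H p β h) (Ioo (-1) 1) := by
  intro x hx
  have h1 : ContDiffAt ℝ n (fun y : ℝ => Real.log (1 + y)) x :=
    (contDiffAt_const.add contDiffAt_id).log (one_add_pos_of_mem hx).ne'
  have h2 : ContDiffAt ℝ n (fun y : ℝ => Real.log (1 - y)) x :=
    (contDiffAt_const.sub contDiffAt_id).log (one_sub_pos_of_mem hx).ne'
  have : ContDiffAt ℝ n (H p β h) x := by
    unfold H entropyFn
    fun_prop
  exact this.contDiffWithinAt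

theorem hasDerivAt_H (p : ℕ) (β h : ℝ) {x : ℝ} (hx : x ∈ Ioo (-1 : ℝ) 1) :
    HasDerivAt (H p β h)
      (β * p * x ^ (p - 1) + h - 1 / 2 * Real.log (1 + x) + 1 / 2 * Real.log (1 - x)) x := by
  have a := one_add_pos_of_mem hx
  have b := one_sub_pos_of_mem hx
  have h1 := ((hasDerivAt_id x).const_add 1).mul (((hasDerivAt_id x).const_add 1).log a.ne')
  have h2 := ((hasDerivAt_id x).const_sub 1).mul (((hasDerivAt_id x).const_sub 1).log b.ne')
  have h3 := ((((hasDerivAt_id x).pow p).const_mul β).add ((hasDerivAt_id x).const_mul h)).sub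
    ((h1.add h2).const_mul (1 / 2))
  refine (h3.congr_deriv ?_).congr_of_eventuallyEq (Eventually.of_forall fun y => ?_)
  · simp only [id]
    field_simp
    ring
  · simp [H, entropyFn]

theorem hasDerivAt_H₁ (p : ℕ) (β h : ℝ) {x : ℝ} (hx : x ∈ Ioo (-1 : ℝ) 1) :
    HasDerivAt
      (fun x => β * p * x ^ (p - 1) + h - 1 / 2 * Real.log (1 + x) + 1 / 2 * Real.log (1 - x))
      (β * p * (p - 1 : ℕ) * x ^ (p - 2) - 1 / (1 - x ^ 2)) x := by
  have a := one_add_pos_of_mem hx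
  have b := one_sub_pos_of_mem hx
  have h1 := (((hasDerivAt_id x).const_add 1).log a.ne').const_mul (1 / 2 : ℝ)
  have h2 := (((hasDerivAt_id x).const_sub 1).log b.ne').const_mul (1 / 2 : ℝ)
  have h3 := (((((hasDerivAt_id x).pow (p - 1)).const_mul (β * p)).add_const h).sub h1).add h2
  refine (h3.congr_deriv ?_).congr_of_eventuallyEq (Eventually.of_forall fun y => ?_)
  · have c : (1 - x ^ 2) = (1 + x) * (1 - x) := by ring
    simp only [id, c, show p - 1 - 1 = p - 2 by omega]
    field_simp
    ring
  · simp

theorem hasDerivAt_H₂ (p : ℕ) (β : ℝ) {x : ℝ} (hx : x ∈ Ioo (-1 : ℝ) 1) :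
    HasDerivAt (fun x => β * p * (p - 1 : ℕ) * x ^ (p - 2) - 1 / (1 - x ^ 2))
      (β * p * (p - 1 : ℕ) * (p - 2 : ℕ) * x ^ (p - 3) - 2 * x / (1 - x ^ 2) ^ 2) x := by
  have c := one_sub_sq_pos_of_mem hx
  have h1 := (((hasDerivAt_id x).pow 2).const_sub 1).inv c.ne'
  have h3 := (((hasDerivAt_id x).pow (p - 2)).const_mul (β * p * (p - 1 : ℕ))).sub h1
  refine (h3.congr_deriv ?_).congr_of_eventuallyEq (Eventually.of_forall fun y => ?_)
  · simp only [id, show p - 2 - 1 = p - 3 by omega]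
    simp
    ring
  · simp

theorem hasDerivAt_H₃ (p : ℕ) (β : ℝ) {x : ℝ} (hx : x ∈ Ioo (-1 : ℝ) 1) :
    HasDerivAt (fun x => β * p * (p - 1 : ℕ) * (p - 2 : ℕ) * x ^ (p - 3) - 2 * x / (1 - x ^ 2) ^ 2)
      (β * p * (p - 1 : ℕ) * (p - 2 : ℕ) * (p - 3 : ℕ) * x ^ (p - 4)
        - (2 + 6 * x ^ 2) / (1 - x ^ 2) ^ 3) x := by
  have c := one_sub_sq_pos_of_mem hx
  have h1 := ((hasDerivAt_id x).const_mul 2).div ((((hasDerivAt_id x).pow 2).const_sub 1).pow 2)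
    (pow_ne_zero 2 c.ne')
  have h3 := (((hasDerivAt_id x).pow (p - 3)).const_mul (β * p * (p - 1 : ℕ) * (p - 2 : ℕ))).sub h1
  refine (h3.congr_deriv ?_).congr_of_eventuallyEq (Eventually.of_forall fun y => ?_)
  · simp only [id, show p - 3 - 1 = p - 4 by omega]
    simp only [Pi.pow_apply, id]
    field_simp
    ring
  · simp

theorem deriv_eq_on_Ioo {f f' g : ℝ → ℝ} (hf : ∀ x ∈ Ioo (-1 : ℝ) 1, f x = g x)
    (hg : ∀ x ∈ Ioo (-1 : ℝ) 1, HasDerivAt g (f' x) x) :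
    ∀ x ∈ Ioo (-1 : ℝ) 1, deriv f x = f' x := fun x hx =>
  ((hg x hx).congr_of_eventuallyEq
    (eventually_of_mem (isOpen_Ioo.mem_nhds hx) hf)).deriv

theorem iteratedDeriv_one_H (p : ℕ) (β h : ℝ) : ∀ x ∈ Ioo (-1 : ℝ) 1,
    iteratedDeriv 1 (H p β h) x
      = β * p * x ^ (p - 1) + h - 1 / 2 * Real.log (1 + x) + 1 / 2 * Real.log (1 - x) := by
  rw [iteratedDeriv_one]
  exact fun x hx => (hasDerivAt_H p β h hx).deriv

theorem iteratedDeriv_two_H (p : ℕ) (β h : ℝ) : ∀ x ∈ Ioo (-1 : ℝ) 1,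
    iteratedDeriv 2 (H p β h) x = β * p * (p - 1 : ℕ) * x ^ (p - 2) - 1 / (1 - x ^ 2) := by
  rw [iteratedDeriv_succ]
  exact deriv_eq_on_Ioo (iteratedDeriv_one_H p β h) fun x hx => hasDerivAt_H₁ p β h hx

theorem iteratedDeriv_three_H (p : ℕ) (β h : ℝ) : ∀ x ∈ Ioo (-1 : ℝ) 1,
    iteratedDeriv 3 (H p β h) x
      = β * p * (p - 1 : ℕ) * (p - 2 : ℕ) * x ^ (p - 3) - 2 * x / (1 - x ^ 2) ^ 2 := by
  rw [iteratedDeriv_succ]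
  exact deriv_eq_on_Ioo (iteratedDeriv_two_H p β h) fun x hx => hasDerivAt_H₂ p β hx

theorem iteratedDeriv_four_H (p : ℕ) (β h : ℝ) : ∀ x ∈ Ioo (-1 : ℝ) 1,
    iteratedDeriv 4 (H p β h) x
      = β * p * (p - 1 : ℕ) * (p - 2 : ℕ) * (p - 3 : ℕ) * x ^ (p - 4)
        - (2 + 6 * x ^ 2) / (1 - x ^ 2) ^ 3 := by
  rw [iteratedDeriv_succ]
  exact deriv_eq_on_Ioo (iteratedDeriv_three_H p β h) fun x hx => hasDerivAt_H₃ p β hx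

theorem taylor_H (p : ℕ) (β h : ℝ) {m : ℝ} (hm : m ∈ Ioo (-1 : ℝ) 1) (n : ℕ) :
    (fun x => H p β h x
      - ∑ k ∈ Finset.range (n + 1), iteratedDeriv k (H p β h) m / k.factorial * (x - m) ^ k)
      =o[𝓝 m] fun x => (x - m) ^ n := by
  have := taylor_isLittleO (convex_Ioo (-1 : ℝ) 1) hm (contDiffOn_H p β h n)
  rw [isOpen_Ioo.nhdsWithin_eq hm] at this
  refine this.congr_left fun x => ?_
  rw [taylor_within_apply]
  congr 1
  refine Finset.sum_congr rfl fun k _ => ?_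
  rw [iteratedDerivWithin_of_isOpen isOpen_Ioo hm, smul_eq_mul]
  field_simp

/-! ### H near a degenerate maximizer -/

namespace IsUniqueGlobalMax

variable {p : ℕ} {β h m : ℝ}

theorem le (hm : IsUniqueGlobalMax p β h m) {x : ℝ} (hx : x ∈ Icc (-1 : ℝ) 1) :
    H p β h x ≤ H p β h m := by
  rcases eq_or_ne x m with rfl | hne
  · rfl
  · exact (hm.2 x hx hne).le

theorem eventually_le (hm : IsUniqueGlobalMax p β h m) : ∀ᶠ x in 𝓝 m, H p β h x ≤ H p β h m :=
  eventually_of_mem (Icc_mem_nhds hm.1.1 hm.1.2) fun _ hx => hm.le hx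

theorem iteratedDeriv_one (hm : IsUniqueGlobalMax p β h m) : iteratedDeriv 1 (H p β h) m = 0 := by
  rw [_root_.iteratedDeriv_one]
  exact IsLocalMax.deriv_eq_zero hm.eventually_le

theorem eq (hm : IsUniqueGlobalMax p β h m) {m' : ℝ} (hm' : IsUniqueGlobalMax p β h m') :
    m' = m := by
  by_contra hne
  have := hm.2 m' (Ioo_subset_Icc_self hm'.1) hne
  exact absurd (hm'.le (Ioo_subset_Icc_self hm.1)) (not_le.2 this)

/-- A nonzero cubic leading term changes sign at m, so H would exceed its maximum on one side. -/
theorem iteratedDeriv_three (hm : IsUniqueGlobalMax p β h m)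
    (h2 : iteratedDeriv 2 (H p β h) m = 0) : iteratedDeriv 3 (H p β h) m = 0 := by
  have ht := taylor_H p β h hm.1 3
  simp only [Finset.sum_range_succ, Finset.range_zero, Finset.sum_empty, h2, hm.iteratedDeriv_one,
    iteratedDeriv_zero] at ht
  set c := iteratedDeriv 3 (H p β h) m with hc
  by_contra hne
  -- The cubic coefficient is c/6; an error of at most half of it cannot reverse its sign.
  have hpos : 0 < |c| / 12 := by positivity
  have hev := (ht.bound hpos).and hm.eventually_le
  obtain ⟨ε, hε, hball⟩ := Metric.eventually_nhds_iff.1 hev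
  have hs : dist (m + SignType.sign c * (ε / 2)) m < ε := by
    rw [Real.dist_eq, add_sub_cancel_left, abs_mul, abs_of_pos (half_pos hε)]
    rcases lt_or_gt_of_ne hne with h' | h' <;> simp [h', hε]
  obtain ⟨h3, h4⟩ := hball hs
  rw [add_sub_cancel_left] at h3
  rcases lt_or_gt_of_ne hne with h' | h'
  · simp only [h', sign_neg, SignType.coe_neg_one, abs_of_neg h', Real.norm_eq_abs] at h3 h4
    rw [show |(-1 * (ε / 2)) ^ 3| = (ε / 2) ^ 3 by
      rw [abs_pow, abs_mul, abs_of_pos (by positivity : 0 < ε / 2)]; simp] at h3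
    have := (abs_le.1 h3).1
    norm_num [Nat.factorial] at this h4
    have h5 : 0 < ε ^ 3 := by positivity
    nlinarith
  · simp only [h', sign_pos, SignType.coe_one, abs_of_pos h', Real.norm_eq_abs] at h3 h4
    rw [show |(1 * (ε / 2)) ^ 3| = (ε / 2) ^ 3 by
      rw [abs_pow, abs_mul, abs_of_pos (by positivity : 0 < ε / 2)]; simp] at h3
    have := (abs_le.1 h3).1
    norm_num [Nat.factorial] at this h4
    have h5 : 0 < ε ^ 3 := by positivity
    nlinarith

/-- The equations H'' = 0 and H''' = 0 at m determine β and p in terms of m: eliminating β leaves (p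
- 2)(1 - m²) = 2m². Substituting both into the fourth derivative leaves an elementary inequality in
m². -/
theorem iteratedDeriv_four_neg (hp : 3 ≤ p) (hm : IsUniqueGlobalMax p β h m)
    (h2 : iteratedDeriv 2 (H p β h) m = 0) : iteratedDeriv 4 (H p β h) m < 0 := by
  have h3 := hm.iteratedDeriv_three h2
  have hpos := one_sub_sq_pos_of_mem hm.1
  rw [iteratedDeriv_two_H p β h m hm.1] at h2
  rw [iteratedDeriv_three_H p β h m hm.1] at h3
  rw [iteratedDeriv_four_H p β h m hm.1]
  obtain ⟨k, rfl⟩ := Nat.exists_eq_add_of_le' hp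
  simp only [show k + 3 - 1 = k + 2 by omega, show k + 3 - 2 = k + 1 by omega,
    show k + 3 - 3 = k by omega, show k + 3 - 4 = k - 1 by omega] at h2 h3 ⊢
  have hm0 : m ≠ 0 := by
    rintro rfl
    simp at h2
  set w := 1 - m ^ 2 with hw
  have e2 : β * (k + 3 : ℕ) * (k + 2 : ℕ) * m ^ (k + 1) * w = 1 := by
    field_simp at h2
    linarith
  have e3 : β * (k + 3 : ℕ) * (k + 2 : ℕ) * (k + 1 : ℕ) * m ^ k * w ^ 2 = 2 * m := by
    field_simp at h3
    linarith
  have hmw : (k + 1 : ℝ) * w = 2 * m ^ 2 := by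
    have : (k + 1 : ℝ) * w * (β * (k + 3 : ℕ) * (k + 2 : ℕ) * m ^ (k + 1) * w)
        = m * (β * (k + 3 : ℕ) * (k + 2 : ℕ) * (k + 1 : ℕ) * m ^ k * w ^ 2) := by
      push_cast; ring
    rw [e2, e3] at this
    linarith
  have hk : (k : ℝ) * (k + 1) * w ^ 2 < 2 * m ^ 2 + 6 * m ^ 4 := by
    have : (k : ℝ) * w = 2 * m ^ 2 - w := by linarith
    calc (k : ℝ) * (k + 1) * w ^ 2 = (k * w) * ((k + 1) * w) := by ring
      _ = (2 * m ^ 2 - w) * (2 * m ^ 2) := by rw [hmw, this]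
      _ < _ := by
        have : 0 < m ^ 2 := by positivity
        nlinarith
  have e4 : β * (k + 3 : ℕ) * (k + 2 : ℕ) * (k + 1 : ℕ) * k * m ^ (k - 1) * m ^ 2 * w
      = k * (k + 1) := by
    -- For `k = 0` the exponent `k - 1` truncates, but the factor `k` makes both sides vanish.
    rcases Nat.eq_zero_or_pos k with rfl | hkpos
    · simp
    · obtain ⟨j, rfl⟩ := Nat.exists_eq_add_of_le' hkpos
      rw [show j + 1 - 1 = j by omega]
      calc _ = ((j + 1 : ℕ) : ℝ) * ((j + 1 : ℕ) + 1)
          * (β * (j + 1 + 3 : ℕ) * (j + 1 + 2 : ℕ) * m ^ (j + 1 + 1) * w) := by push_cast; ring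
        _ = _ := by rw [e2, mul_one]
  rw [sub_neg, lt_div_iff₀ (by positivity)]
  have hm2 : 0 < m ^ 2 := by positivity
  refine lt_of_mul_lt_mul_right ?_ hm2.le
  calc _ = (β * (k + 3 : ℕ) * (k + 2 : ℕ) * (k + 1 : ℕ) * k * m ^ (k - 1) * m ^ 2 * w) * w ^ 2 := by
        ring
    _ = k * (k + 1) * w ^ 2 := by rw [e4]
    _ < 2 * m ^ 2 + 6 * m ^ 4 := hk
    _ = _ := by ring

theorem taylor_four (hm : IsUniqueGlobalMax p β h m) (h2 : iteratedDeriv 2 (H p β h) m = 0) :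
    (fun x => H p β h x - H p β h m - iteratedDeriv 4 (H p β h) m / 24 * (x - m) ^ 4)
      =o[𝓝 m] fun x => (x - m) ^ 4 := by
  refine (taylor_H p β h hm.1 4).congr_left fun x => ?_
  simp [Finset.sum_range_succ, h2, hm.iteratedDeriv_one, hm.iteratedDeriv_three h2, Nat.factorial]
  ring

/-- Near m the Taylor expansion gives the bound with half the quartic coefficient. Elsewhere
compactness and uniqueness give a positive gap, which dominates a multiple of (x - m)^4 because |x -
m| ≤ 2. -/
theorem exists_quartic_bound (hm : IsUniqueGlobalMax p β h m)
    (h2 : iteratedDeriv 2 (H p β h) m = 0) (h4 : iteratedDeriv 4 (H p β h) m < 0) :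
    ∃ c > 0, ∀ x ∈ Icc (-1 : ℝ) 1, H p β h x - H p β h m ≤ -c * (x - m) ^ 4 := by
  set q := iteratedDeriv 4 (H p β h) m with hq
  have ht := (hm.taylor_four h2).bound (c := -q / 48) (by linarith)
  obtain ⟨ε, hε, hball⟩ := Metric.eventually_nhds_iff.1 ht
  have hcomp : IsCompact (Icc (-1 : ℝ) 1 \ Metric.ball m ε) := isCompact_Icc.diff Metric.isOpen_ball
  have hlocal : ∀ x, dist x m < ε → H p β h x - H p β h m ≤ q / 48 * (x - m) ^ 4 := by
    intro x hx
    have := hball hx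
    rw [Real.norm_eq_abs, Real.norm_eq_abs, abs_of_nonneg (by positivity : 0 ≤ (x - m) ^ 4)] at this
    have := (abs_le.1 this).2
    linarith
  rcases (Icc (-1 : ℝ) 1 \ Metric.ball m ε).eq_empty_or_nonempty with he | hne
  · refine ⟨-q / 48, by linarith, fun x hx => ?_⟩
    have : x ∈ Metric.ball m ε := by
      by_contra hx'
      exact (he ▸ (⟨hx, hx'⟩ : x ∈ Icc (-1 : ℝ) 1 \ Metric.ball m ε) : x ∈ (∅ : Set ℝ))
    have := hlocal x this
    linarith
  · obtain ⟨x₀, hx₀, hmax⟩ := hcomp.exists_isMaxOn hne (continuous_H p β h).continuousOn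
    have hne0 : x₀ ≠ m := by
      rintro rfl
      exact hx₀.2 (Metric.mem_ball_self hε)
    have hgap := hm.2 x₀ hx₀.1 hne0
    refine ⟨min (-q / 48) ((H p β h m - H p β h x₀) / 16), lt_min (by linarith) (by linarith),
      fun x hx => ?_⟩
    have hnn : 0 ≤ (x - m) ^ 4 := by positivity
    by_cases hx' : x ∈ Metric.ball m ε
    · have := hlocal x hx'
      have := mul_le_mul_of_nonneg_right
        (min_le_left (-q / 48) ((H p β h m - H p β h x₀) / 16)) hnn
      linarith
    · have h1 : H p β h x ≤ H p β h x₀ := hmax ⟨hx, hx'⟩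
      have h16 : (x - m) ^ 4 ≤ 16 := by
        have : |x - m| ≤ 2 := abs_le.2 ⟨by linarith [hx.1, hm.1.2], by linarith [hx.2, hm.1.1]⟩
        calc (x - m) ^ 4 = |x - m| ^ 4 := (Even.pow_abs (by decide) _).symm
          _ ≤ 2 ^ 4 := by gcongr
          _ = 16 := by norm_num
      have := mul_le_mul_of_nonneg_right
        (min_le_right (-q / 48) ((H p β h m - H p β h x₀) / 16)) hnn
      nlinarith

end IsUniqueGlobalMax

/-! ### Weights of the magnetization levels -/

/-- The magnetization per spin of a configuration of `N` spins with `k` spins up. -/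
def magVal (N k : ℕ) : ℝ := (2 * k - N) / N

/-- The centred and rescaled magnetization of a configuration of `N` spins with `k` spins up. -/
def fluctVal (m : ℝ) (N k : ℕ) : ℝ := (N : ℝ) ^ (1 / 4 : ℝ) * (magVal N k - m)

/-- The total weight of the configurations with `k` spins up, normalized by the exponential rate
at the maximizer. -/
def levelWeight (p : ℕ) (β h m : ℝ) (N k : ℕ) : ℝ :=
  √N * (N.choose k * Real.exp (N * (β * magVal N k ^ p + h * magVal N k)))
    / (2 ^ N * Real.exp (N * H p β h m))

theorem levelWeight_nonneg (p : ℕ) (β h m : ℝ) (N k : ℕ) : 0 ≤ levelWeight p β h m N k := by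
  unfold levelWeight
  positivity

theorem magVal_mem_Icc {N k : ℕ} (hN : 0 < N) (hk : k ≤ N) : magVal N k ∈ Icc (-1 : ℝ) 1 := by
  have h1 : (0 : ℝ) < N := by exact_mod_cast hN
  have h2 : (k : ℝ) ≤ N := by exact_mod_cast hk
  have h3 : (0 : ℝ) ≤ k := k.cast_nonneg
  unfold magVal
  rw [mem_Icc, le_div_iff₀ h1, div_le_iff₀ h1]
  constructor <;> linarith

theorem one_add_magVal {N : ℕ} (hN : 0 < N) (k : ℕ) : 1 + magVal N k = 2 * k / N := by
  have h1 : (0 : ℝ) < N := by exact_mod_cast hN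
  unfold magVal
  field_simp
  ring

theorem one_sub_magVal {N k : ℕ} (hN : 0 < N) (hk : k ≤ N) :
    1 - magVal N k = 2 * (N - k : ℕ) / N := by
  have h1 : (0 : ℝ) < N := by exact_mod_cast hN
  unfold magVal
  rw [Nat.cast_sub hk]
  field_simp
  ring

theorem fluctVal_pow_four (m : ℝ) (N k : ℕ) :
    fluctVal m N k ^ 4 = N * (magVal N k - m) ^ 4 := by
  unfold fluctVal
  rw [mul_pow, ← Real.rpow_natCast, ← Real.rpow_mul N.cast_nonneg]
  norm_num

theorem factorial_eq_stirlingSeq {n : ℕ} (hn : 0 < n) :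
    (n.factorial : ℝ) = Stirling.stirlingSeq n * √(2 * n) * Real.exp (n * Real.log n - n) := by
  have h1 : (0 : ℝ) < n := by exact_mod_cast hn
  have h2 : Real.exp (n * Real.log n - n) = (n / Real.exp 1) ^ n := by
    rw [div_pow, ← Real.exp_nat_mul, Real.exp_sub, mul_one, mul_comm (n : ℝ) (Real.log n),
      ← Real.rpow_def_of_pos h1, Real.rpow_natCast]
  rw [h2]
  unfold Stirling.stirlingSeq
  field_simp

/-- Stirling's formula for the level weights. -/
theorem levelWeight_eq (p : ℕ) (β h m : ℝ) {N k : ℕ} (hk : 0 < k) (hkN : k < N) :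
    levelWeight p β h m N k =
      Stirling.stirlingSeq N / (Stirling.stirlingSeq k * Stirling.stirlingSeq (N - k))
        * √(2 / (1 - magVal N k ^ 2))
        * Real.exp (N * (H p β h (magVal N k) - H p β h m)) := by
  obtain ⟨j, rfl⟩ := Nat.exists_eq_add_of_lt hkN
  set l := j + 1 with hl
  rw [show k + j + 1 = k + l by omega] at hkN ⊢
  rw [show k + l - k = l by omega]
  have hl0 : 0 < l := by omega
  have hN0 : 0 < k + l := by omega
  have kpos : (0 : ℝ) < k := by exact_mod_cast hk
  have lpos : (0 : ℝ) < l := by exact_mod_cast hl0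
  have npos : (0 : ℝ) < (k + l : ℕ) := by exact_mod_cast hN0
  have ncast : ((k + l : ℕ) : ℝ) = k + l := by push_cast; ring
  have sk : 0 < Stirling.stirlingSeq k :=
    (Real.sqrt_pos.2 Real.pi_pos).trans_le (Stirling.sqrt_pi_le_stirlingSeq hk.ne')
  have sl : 0 < Stirling.stirlingSeq l :=
    (Real.sqrt_pos.2 Real.pi_pos).trans_le (Stirling.sqrt_pi_le_stirlingSeq hl0.ne')
  have ha := one_add_magVal hN0 k
  have hb := one_sub_magVal hN0 hkN.le
  rw [show k + l - k = l by omega] at hb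
  have hab : 1 - magVal (k + l) k ^ 2 = 4 * k * l / (k + l : ℕ) ^ 2 := by
    rw [show 1 - magVal (k + l) k ^ 2 = (1 + magVal (k + l) k) * (1 - magVal (k + l) k) by ring,
      ha, hb]
    field_simp
    ring
  -- The exponential rate of the binomial coefficient is exactly the entropy term in H.
  have hent : ((k + l : ℕ) : ℝ) * entropyFn (magVal (k + l) k)
      = (k + l : ℕ) * Real.log 2 + k * Real.log k + l * Real.log l
        - (k + l : ℕ) * Real.log (k + l : ℕ) := by
    unfold entropyFn
    rw [ha, hb, Real.log_div (by positivity) npos.ne', Real.log_div (by positivity) npos.ne',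
      Real.log_mul two_ne_zero kpos.ne', Real.log_mul two_ne_zero lpos.ne']
    field_simp
    rw [ncast]
    ring
  have hchoose : ((k + l).choose k : ℝ)
      = (k + l).factorial / (k.factorial * l.factorial) := by
    rw [Nat.cast_choose ℝ (Nat.le_add_right k l), show k + l - k = l by omega]
  have hroot : √((k + l : ℕ) : ℝ) * (√(2 * (k + l : ℕ)) / (√(2 * k) * √(2 * l)))
      = √(2 / (4 * k * l / (k + l : ℕ) ^ 2)) := by
    rw [← Real.sqrt_mul (by positivity), ← Real.sqrt_div (by positivity),
      ← Real.sqrt_mul (by positivity)]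
    congr 1
    field_simp
    norm_num
  rw [hab, ← hroot]
  have hexp : Real.exp ((k + l : ℕ) * (H p β h (magVal (k + l) k) - H p β h m))
      = Real.exp ((k + l : ℕ) * (β * magVal (k + l) k ^ p + h * magVal (k + l) k))
        * (Real.exp ((k + l : ℕ) * Real.log (k + l : ℕ) - (k + l : ℕ))
          / (Real.exp (k * Real.log k - k) * Real.exp (l * Real.log l - l)))
        / (2 ^ (k + l) * Real.exp ((k + l : ℕ) * H p β h m)) := by
    have h2 : (2 : ℝ) ^ (k + l) = Real.exp ((k + l : ℕ) * Real.log 2) := by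
      rw [mul_comm, ← Real.rpow_def_of_pos two_pos, Real.rpow_natCast]
    rw [h2, ← Real.exp_add, ← Real.exp_sub, ← Real.exp_add, ← Real.exp_add, ← Real.exp_sub]
    congr 1
    rw [mul_sub]
    conv_lhs => rw [H, mul_sub, hent]
    rw [ncast]
    ring
  rw [hexp]
  unfold levelWeight
  rw [hchoose, factorial_eq_stirlingSeq hk, factorial_eq_stirlingSeq hl0,
    factorial_eq_stirlingSeq hN0]
  field_simp

theorem entropyFn_one : entropyFn 1 = Real.log 2 := by
  norm_num [entropyFn]
  ring

theorem entropyFn_neg_one : entropyFn (-1) = Real.log 2 := by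
  norm_num [entropyFn]
  ring

theorem levelWeight_eq_of_endpoint (p : ℕ) (β h m : ℝ) {N k : ℕ} (hN : 0 < N)
    (hk : k = 0 ∨ k = N) :
    levelWeight p β h m N k = √N * Real.exp (N * (H p β h (magVal N k) - H p β h m)) := by
  have hN' : (N : ℝ) ≠ 0 := by exact_mod_cast hN.ne'
  have h2 : (2 : ℝ) ^ N = Real.exp (N * Real.log 2) := by
    rw [mul_comm, ← Real.rpow_def_of_pos two_pos, Real.rpow_natCast]
  have hc : (N.choose k : ℝ) = 1 := by rcases hk with rfl | rfl <;> simp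
  have he : entropyFn (magVal N k) = Real.log 2 := by
    rcases hk with rfl | rfl
    · rw [show magVal N 0 = -1 by simp [magVal, neg_div, div_self hN'], entropyFn_neg_one]
    · rw [show magVal k k = 1 by unfold magVal; field_simp; ring, entropyFn_one]
  unfold levelWeight
  rw [hc, one_mul, h2, ← Real.exp_add, mul_div_assoc, ← Real.exp_sub]
  congr 2
  conv_rhs => rw [H, he]
  ring

theorem stirlingSeq_le_stirlingSeq_one {n : ℕ} (hn : 0 < n) :
    Stirling.stirlingSeq n ≤ Stirling.stirlingSeq 1 := by
  obtain ⟨k, rfl⟩ := Nat.exists_eq_add_of_le' hn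
  exact Stirling.stirlingSeq'_antitone (Nat.zero_le k)

theorem stirlingSeq_quotient_le {k l N : ℕ} (hk : 0 < k) (hl : 0 < l) (hN : 0 < N) :
    Stirling.stirlingSeq N / (Stirling.stirlingSeq k * Stirling.stirlingSeq l)
      ≤ Stirling.stirlingSeq 1 / Real.pi := by
  have hpi := Real.sqrt_pos.2 Real.pi_pos
  have h1 := Stirling.sqrt_pi_le_stirlingSeq hk.ne'
  have h2 := Stirling.sqrt_pi_le_stirlingSeq hl.ne'
  have h3 : Real.pi ≤ Stirling.stirlingSeq k * Stirling.stirlingSeq l := by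
    calc Real.pi = √Real.pi * √Real.pi := (Real.mul_self_sqrt Real.pi_pos.le).symm
      _ ≤ _ := mul_le_mul h1 h2 hpi.le (hpi.le.trans h1)
  have := (hpi.trans_le (Stirling.sqrt_pi_le_stirlingSeq one_ne_zero)).le
  exact div_le_div₀ this (stirlingSeq_le_stirlingSeq_one hN) Real.pi_pos h3

theorem levelWeight_le_of_interior (p : ℕ) (β h m : ℝ) {N k : ℕ} (hk : 0 < k) (hkN : k < N) :
    levelWeight p β h m N k ≤ Stirling.stirlingSeq 1 / Real.pi * √(2 / (1 - magVal N k ^ 2))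
        * Real.exp (N * (H p β h (magVal N k) - H p β h m)) := by
  rw [levelWeight_eq p β h m hk hkN]
  exact mul_le_mul_of_nonneg_right (mul_le_mul_of_nonneg_right
    (stirlingSeq_quotient_le hk (by omega) (by omega)) (Real.sqrt_nonneg _)) (Real.exp_pos _).le

theorem levelWeight_le_sqrt_mul (p : ℕ) (β h m : ℝ) {N k : ℕ} (hN : 0 < N) (hkN : k ≤ N) :
    levelWeight p β h m N k ≤ max 1 (Stirling.stirlingSeq 1 / Real.pi) * √N
        * Real.exp (N * (H p β h (magVal N k) - H p β h m)) := by
  by_cases hend : k = 0 ∨ k = N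
  · rw [levelWeight_eq_of_endpoint p β h m hN hend]
    gcongr
    exact le_mul_of_one_le_left (Real.sqrt_nonneg _) (le_max_left _ _)
  · push Not at hend
    have hk : 0 < k := Nat.pos_of_ne_zero hend.1
    have hl : 0 < N - k := by omega
    refine (levelWeight_le_of_interior p β h m hk (by omega)).trans ?_
    have h1 : (0 : ℝ) < N := by exact_mod_cast hN
    -- Here 1 - x² = 4k(N - k)/N², and k(N - k) ≥ N/2 since both factors are at least 1.
    have hsq : 2 / (1 - magVal N k ^ 2) ≤ N := by
      rw [show 1 - magVal N k ^ 2 = (1 + magVal N k) * (1 - magVal N k) by ring,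
        one_add_magVal hN, one_sub_magVal hN hkN]
      have hk1 : (1 : ℝ) ≤ k := by exact_mod_cast hk
      have hl1 : (1 : ℝ) ≤ (N - k : ℕ) := by exact_mod_cast hl
      have hsum : (N : ℝ) = k + (N - k : ℕ) := by
        rw [Nat.cast_sub hkN]; ring
      rw [div_le_iff₀ (by positivity)]
      have : (N : ℝ) * (2 * k / N * (2 * (N - k : ℕ) / N)) = 4 * k * (N - k : ℕ) / N := by
        field_simp
        ring
      rw [this, le_div_iff₀ h1]
      nlinarith
    gcongr
    exact le_max_right _ _

/-- Half of the quartic exponent is kept for the bound. The other half absorbs the factor √N when x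
is far from m; when x is near m it is not needed, since the Stirling prefactor is bounded away from
±1. -/
theorem exists_levelWeight_bound {p : ℕ} {β h m : ℝ} (hm : m ∈ Ioo (-1 : ℝ) 1)
    {c : ℝ} (hc : 0 < c)
    (hH : ∀ x ∈ Icc (-1 : ℝ) 1, H p β h x - H p β h m ≤ -c * (x - m) ^ 4) :
    ∃ C > 0, ∀ N k : ℕ, 0 < N → k ≤ N →
      levelWeight p β h m N k ≤ C * Real.exp (-(c / 2) * fluctVal m N k ^ 4) := by
  -- Points within δ of m keep distance at least δ from ±1.
  obtain ⟨δ, hδ, hδm⟩ : ∃ δ > 0, |m| + 2 * δ = 1 :=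
    ⟨(1 - |m|) / 2, by have := abs_lt.2 hm; linarith, by ring⟩
  set A := max 1 (Stirling.stirlingSeq 1 / Real.pi) with hA
  have hA1 : 1 ≤ A := le_max_left _ _
  have hd : 0 < c / 2 * δ ^ 4 := by positivity
  have hexp : ∀ N k : ℕ, 0 < N → k ≤ N →
      Real.exp (N * (H p β h (magVal N k) - H p β h m))
        ≤ Real.exp (-(c / 2) * fluctVal m N k ^ 4)
          * Real.exp (-(c / 2) * (N * (magVal N k - m) ^ 4)) := by
    intro N k hN hk
    rw [← Real.exp_add, Real.exp_le_exp, fluctVal_pow_four]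
    have := mul_le_mul_of_nonneg_left (hH _ (magVal_mem_Icc hN hk)) (N.cast_nonneg (α := ℝ))
    linarith
  refine ⟨A * √(2 / δ) + A / (c / 2 * δ ^ 4), by positivity, fun N k hN hk => ?_⟩
  have hN' : (1 : ℝ) ≤ N := by exact_mod_cast hN
  have hE := hexp N k hN hk
  by_cases hclose : |magVal N k - m| ≤ δ
  · have habs : |magVal N k| ≤ 1 - δ := by
      have := abs_add_le (magVal N k - m) m
      rw [sub_add_cancel] at this
      linarith
    have hmv : δ ≤ 1 - magVal N k ^ 2 := by
      have := sq_le_sq' (by linarith [(abs_le.1 habs).1]) (abs_le.1 habs).2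
      have hδ1 : δ ≤ 1 := by linarith [abs_nonneg m]
      nlinarith
    have hk0 : 0 < k := by
      refine Nat.pos_of_ne_zero ?_
      rintro rfl
      have : magVal N 0 = -1 := by
        simp [magVal, neg_div, div_self (by positivity : (N : ℝ) ≠ 0)]
      rw [this] at habs
      norm_num at habs
      linarith
    have hkN : k < N := by
      refine lt_of_le_of_ne hk ?_
      rintro rfl
      have : magVal k k = 1 := by
        unfold magVal
        have : (k : ℝ) ≠ 0 := by positivity
        field_simp
        ring
      rw [this] at habs
      norm_num at habs
      linarith
    calc levelWeight p β h m N k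
        ≤ Stirling.stirlingSeq 1 / Real.pi * √(2 / (1 - magVal N k ^ 2))
          * Real.exp (N * (H p β h (magVal N k) - H p β h m)) :=
          levelWeight_le_of_interior p β h m hk0 hkN
      _ ≤ A * √(2 / δ) * (Real.exp (-(c / 2) * fluctVal m N k ^ 4) * 1) := by
          gcongr
          · exact le_max_right _ _
          · refine hE.trans ?_
            gcongr
            rw [Real.exp_le_one_iff]
            have : 0 ≤ c / 2 * (N * (magVal N k - m) ^ 4) := by positivity
            linarith
      _ ≤ _ := by
          rw [mul_one]
          gcongr
          have : 0 ≤ A / (c / 2 * δ ^ 4) := by positivity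
          linarith
  · push Not at hclose
    have hpow : δ ^ 4 ≤ (magVal N k - m) ^ 4 := by
      rw [← Even.pow_abs (by decide : Even 4) (magVal N k - m)]
      gcongr
    have hsqrt : √N * Real.exp (-(c / 2) * (N * (magVal N k - m) ^ 4)) ≤ 1 / (c / 2 * δ ^ 4) := by
      have h1 : √(N : ℝ) ≤ N := by
        rw [Real.sqrt_le_left (by positivity)]
        nlinarith
      have h2 : Real.exp (-(c / 2) * (N * (magVal N k - m) ^ 4))
          ≤ (Real.exp (c / 2 * δ ^ 4 * N))⁻¹ := by
        rw [← Real.exp_neg, Real.exp_le_exp]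
        have : c / 2 * (N * δ ^ 4) ≤ c / 2 * (N * (magVal N k - m) ^ 4) := by gcongr
        linarith
      have h3 : c / 2 * δ ^ 4 * N ≤ Real.exp (c / 2 * δ ^ 4 * N) := by
        linarith [Real.add_one_le_exp (c / 2 * δ ^ 4 * N)]
      calc _ ≤ N * (Real.exp (c / 2 * δ ^ 4 * N))⁻¹ := by gcongr
        _ ≤ N * (c / 2 * δ ^ 4 * N)⁻¹ := by gcongr
        _ = _ := by field_simp
    calc levelWeight p β h m N k
        ≤ A * √N * Real.exp (N * (H p β h (magVal N k) - H p β h m)) :=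
          levelWeight_le_sqrt_mul p β h m hN hk
      _ ≤ A * √N * (Real.exp (-(c / 2) * fluctVal m N k ^ 4)
          * Real.exp (-(c / 2) * (N * (magVal N k - m) ^ 4))) := by gcongr
      _ = A * (√N * Real.exp (-(c / 2) * (N * (magVal N k - m) ^ 4)))
          * Real.exp (-(c / 2) * fluctVal m N k ^ 4) := by ring
      _ ≤ A * (1 / (c / 2 * δ ^ 4)) * Real.exp (-(c / 2) * fluctVal m N k ^ 4) := by gcongr
      _ ≤ _ := by
          gcongr
          rw [mul_one_div]
          have : 0 ≤ A * √(2 / δ) := by positivity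
          linarith

theorem tendsto_rpow_neg_natCast {s : ℝ} (hs : 0 < s) :
    Tendsto (fun N : ℕ => (N : ℝ) ^ (-s)) atTop (𝓝 0) :=
  (tendsto_rpow_neg_atTop hs).comp tendsto_natCast_atTop_atTop

theorem tendsto_magVal {m y : ℝ} {k : ℕ → ℕ}
    (hk : Tendsto (fun N => fluctVal m N (k N)) atTop (𝓝 y)) :
    Tendsto (fun N => magVal N (k N)) atTop (𝓝 m) := by
  have h1 := ((tendsto_rpow_neg_natCast (s := 1 / 4) (by norm_num)).mul hk).const_add m
  rw [zero_mul, add_zero] at h1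
  refine h1.congr' ?_
  filter_upwards [eventually_gt_atTop 0] with N hN
  have h0 : (0 : ℝ) < N := by exact_mod_cast hN
  unfold fluctVal
  rw [← mul_assoc, ← Real.rpow_add h0]
  norm_num

/-- A local limit theorem: k and N - k both tend to infinity, so the Stirling factors converge,
while N (x - m)^4 = w^4 turns the Taylor expansion into the quartic exponent. -/
theorem tendsto_levelWeight {p : ℕ} {β h m : ℝ} (hm : IsUniqueGlobalMax p β h m)
    (h2 : iteratedDeriv 2 (H p β h) m = 0) {y : ℝ} {k : ℕ → ℕ}
    (hkN : ∀ᶠ N in atTop, k N ≤ N)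
    (hk : Tendsto (fun N => fluctVal m N (k N)) atTop (𝓝 y)) :
    Tendsto (fun N => levelWeight p β h m N (k N)) atTop
      (𝓝 (√Real.pi / (√Real.pi * √Real.pi) * √(2 / (1 - m ^ 2))
        * Real.exp (iteratedDeriv 4 (H p β h) m / 24 * y ^ 4))) := by
  have hmag := tendsto_magVal hk
  have hmpos := one_sub_sq_pos_of_mem hm.1
  have hkeq : ∀ᶠ N : ℕ in atTop, (k N : ℝ) = (1 + magVal N (k N)) / 2 * N := by
    filter_upwards [eventually_gt_atTop 0] with N hN
    rw [one_add_magVal hN]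
    field_simp
  have hleq : ∀ᶠ N : ℕ in atTop, ((N - k N : ℕ) : ℝ) = (1 - magVal N (k N)) / 2 * N := by
    filter_upwards [eventually_gt_atTop 0, hkN] with N hN hN'
    rw [one_sub_magVal hN hN']
    field_simp
  have hktop : Tendsto k atTop atTop := by
    rw [← tendsto_natCast_atTop_iff (R := ℝ)]
    refine Tendsto.congr' (EventuallyEq.symm hkeq) ?_
    exact ((hmag.const_add 1).div_const 2).pos_mul_atTop
      (half_pos (one_add_pos_of_mem hm.1)) tendsto_natCast_atTop_atTop
  have hltop : Tendsto (fun N => N - k N) atTop atTop := by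
    rw [← tendsto_natCast_atTop_iff (R := ℝ)]
    refine Tendsto.congr' (EventuallyEq.symm hleq) ?_
    exact ((hmag.const_sub 1).div_const 2).pos_mul_atTop
      (half_pos (one_sub_pos_of_mem hm.1)) tendsto_natCast_atTop_atTop
  have hpi := (Real.sqrt_pos.2 Real.pi_pos).ne'
  have hst := Stirling.tendsto_stirlingSeq_sqrt_pi
  have hS := hst.div ((hst.comp hktop).mul (hst.comp hltop)) (mul_ne_zero hpi hpi)
  have hR : Tendsto (fun N => √(2 / (1 - magVal N (k N) ^ 2))) atTop (𝓝 (√(2 / (1 - m ^ 2)))) :=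
    (tendsto_const_nhds.div ((hmag.pow 2).const_sub 1) hmpos.ne').sqrt
  have hE : Tendsto (fun N : ℕ => (N : ℝ) * (H p β h (magVal N (k N)) - H p β h m)) atTop
      (𝓝 (iteratedDeriv 4 (H p β h) m / 24 * y ^ 4)) := by
    set q := iteratedDeriv 4 (H p β h) m / 24 with hq
    have ho := (hm.taylor_four h2).comp_tendsto hmag
    have ho2 := (Asymptotics.isBigO_refl (fun N : ℕ => (N : ℝ)) atTop).mul_isLittleO ho
    have hpow : Tendsto (fun N : ℕ => (N : ℝ) * (magVal N (k N) - m) ^ 4) atTop (𝓝 (y ^ 4)) :=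
      (hk.pow 4).congr fun N => fluctVal_pow_four m N (k N)
    have hz : Tendsto (fun N : ℕ => (N : ℝ) * (H p β h (magVal N (k N)) - H p β h m
        - q * (magVal N (k N) - m) ^ 4)) atTop (𝓝 0) := by
      rw [← Asymptotics.isLittleO_one_iff ℝ]
      exact ho2.trans_isBigO (hpow.isBigO_one ℝ)
    have := hz.add (hpow.const_mul q)
    rw [zero_add] at this
    refine this.congr fun N => ?_
    ring
  refine ((hS.mul hR).mul (Real.continuous_exp.continuousAt.tendsto.comp hE)).congr' ?_
  filter_upwards [hktop.eventually_gt_atTop 0, hltop.eventually_gt_atTop 0] with N h1 h3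
  rw [levelWeight_eq p β h m h1 (by omega)]
  rfl


/-! ### Riemann sums over the magnetization lattice -/

theorem fluctVal_succ (m : ℝ) {N : ℕ} (hN : 0 < N) (k : ℕ) :
    fluctVal m N (k + 1) = fluctVal m N k + 2 * (N : ℝ) ^ (-(3 / 4) : ℝ) := by
  have h0 : (0 : ℝ) < N := by exact_mod_cast hN
  have : (N : ℝ) ^ (1 / 4 : ℝ) = (N : ℝ) ^ (-(3 / 4) : ℝ) * N := by
    rw [← Real.rpow_add_one h0.ne']
    norm_num
  unfold fluctVal magVal
  rw [this]
  push_cast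
  field_simp
  ring

/-- The (real-valued) number of spins up at which the rescaled magnetization equals `y`. -/
def levelOf (m : ℝ) (N : ℕ) (y : ℝ) : ℝ := (1 + m + y * (N : ℝ) ^ (-(1 / 4) : ℝ)) / 2 * N

theorem fluctVal_le_iff (m : ℝ) {N : ℕ} (hN : 0 < N) (k : ℕ) (y : ℝ) :
    fluctVal m N k ≤ y ↔ (k : ℝ) ≤ levelOf m N y := by
  have h0 : (0 : ℝ) < N := by exact_mod_cast hN
  have h1 : 0 < (N : ℝ) ^ (1 / 4 : ℝ) := Real.rpow_pos_of_pos h0 _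
  unfold fluctVal levelOf magVal
  rw [Real.rpow_neg h0.le, ← div_eq_mul_inv, ← le_div_iff₀' h1, sub_le_iff_le_add,
    div_le_iff₀ h0]
  constructor <;> intro h <;> nlinarith

/-- Identifies the only cell that can contain y, so that `stepFn` has at most one nonzero term. The
sign condition excludes negative levels, whose natural floor would be 0. -/
theorem mem_cell_iff (m : ℝ) {N : ℕ} (hN : 0 < N) (k : ℕ) (y : ℝ) :
    y ∈ Ico (fluctVal m N k) (fluctVal m N (k + 1)) ↔
      0 ≤ levelOf m N y ∧ ⌊levelOf m N y⌋₊ = k := by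
  rw [mem_Ico, ← not_le, fluctVal_le_iff m hN, fluctVal_le_iff m hN, not_le]
  push_cast
  constructor
  · intro h
    have h0 : 0 ≤ levelOf m N y := k.cast_nonneg.trans h.1
    exact ⟨h0, (Nat.floor_eq_iff h0).2 h⟩
  · rintro ⟨h0, h⟩
    exact (Nat.floor_eq_iff h0).1 h

/-- The step function whose value on the cell of the level `k` is `F k`. -/
def stepFn (m : ℝ) (N : ℕ) (F : ℕ → ℝ) (y : ℝ) : ℝ :=
  ∑ k ∈ Finset.range (N + 1),
    (Ico (fluctVal m N k) (fluctVal m N (k + 1))).indicator (fun _ => F k) y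

theorem stepFn_of_mem {m : ℝ} {N : ℕ} (hN : 0 < N) (F : ℕ → ℝ) {y : ℝ}
    (h0 : 0 ≤ levelOf m N y) (hle : ⌊levelOf m N y⌋₊ ≤ N) :
    stepFn m N F y = F ⌊levelOf m N y⌋₊ := by
  unfold stepFn
  rw [Finset.sum_eq_single ⌊levelOf m N y⌋₊, indicator_of_mem]
  · exact (mem_cell_iff m hN _ _).2 ⟨h0, rfl⟩
  · intro k _ hk
    exact indicator_of_notMem (fun h => hk ((mem_cell_iff m hN _ _).1 h).2.symm) _
  · intro h
    exact absurd (Finset.mem_range.2 (Nat.lt_succ_of_le hle)) h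

theorem stepFn_of_not_mem {m : ℝ} {N : ℕ} (hN : 0 < N) (F : ℕ → ℝ) {y : ℝ}
    (h : ¬ (0 ≤ levelOf m N y ∧ ⌊levelOf m N y⌋₊ ≤ N)) :
    stepFn m N F y = 0 := by
  refine Finset.sum_eq_zero fun k hk => indicator_of_notMem (fun hmem => h ?_) _
  obtain ⟨h0, h1⟩ := (mem_cell_iff m hN _ _).1 hmem
  exact ⟨h0, h1 ▸ Nat.lt_succ_iff.1 (Finset.mem_range.1 hk)⟩

theorem abs_fluctVal_sub_le {m : ℝ} {N : ℕ} (hN : 0 < N) {y : ℝ} (h0 : 0 ≤ levelOf m N y) :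
    |fluctVal m N ⌊levelOf m N y⌋₊ - y| ≤ 2 * (N : ℝ) ^ (-(3 / 4) : ℝ) := by
  have := (mem_cell_iff m hN _ _).2 ⟨h0, rfl⟩
  rw [fluctVal_succ m hN, mem_Ico] at this
  have h1 : 0 < (N : ℝ) ^ (-(3 / 4) : ℝ) := Real.rpow_pos_of_pos (by exact_mod_cast hN) _
  rw [abs_le]
  constructor <;> linarith [this.1, this.2]

theorem integrable_exp_neg_abs : Integrable (fun y : ℝ => Real.exp (-|y|)) := by
  rw [← integrableOn_univ, ← Iic_union_Ioi (a := (0 : ℝ)), integrableOn_union]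
  constructor
  · refine (integrableOn_exp_Iic 0).congr_fun (fun y hy => ?_) measurableSet_Iic
    rw [abs_of_nonpos hy, neg_neg]
  · refine (integrableOn_exp_neg_Ioi 0).congr_fun (fun y hy => ?_) measurableSet_Ioi
    rw [abs_of_pos hy]

theorem integral_stepFn (m : ℝ) {N : ℕ} (hN : 0 < N) (F : ℕ → ℝ) :
    ∫ y, stepFn m N F y = 2 * (N : ℝ) ^ (-(3 / 4) : ℝ) * ∑ k ∈ Finset.range (N + 1), F k := by
  unfold stepFn
  rw [integral_finsetSum, Finset.mul_sum]
  · refine Finset.sum_congr rfl fun k _ => ?_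
    rw [integral_indicator measurableSet_Ico, setIntegral_const, measureReal_def, Real.volume_Ico,
      fluctVal_succ m hN, add_sub_cancel_left, ENNReal.toReal_ofReal (by positivity), smul_eq_mul]
  · intro k _
    refine IntegrableOn.integrable_indicator ?_ measurableSet_Ico
    exact integrableOn_const (by simp)

theorem tendsto_levelOf_div (m y : ℝ) :
    Tendsto (fun N : ℕ => (1 + m + y * (N : ℝ) ^ (-(1 / 4) : ℝ)) / 2) atTop
      (𝓝 ((1 + m) / 2)) := by
  have := (((tendsto_rpow_neg_natCast (s := 1 / 4) (by norm_num)).const_mul y).const_add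
    (1 + m)).div_const 2
  simpa using this

theorem eventually_levelOf {m : ℝ} (hm : m ∈ Ioo (-1 : ℝ) 1) (y : ℝ) :
    ∀ᶠ N : ℕ in atTop, 0 ≤ levelOf m N y ∧ ⌊levelOf m N y⌋₊ ≤ N := by
  have h1 := one_add_pos_of_mem hm
  have h2 := one_sub_pos_of_mem hm
  filter_upwards [(tendsto_levelOf_div m y).eventually (lt_mem_nhds (half_pos h1)),
    (tendsto_levelOf_div m y).eventually (gt_mem_nhds (show (1 + m) / 2 < 1 by linarith))]
    with N ha hb
  have h3 : 0 ≤ levelOf m N y := mul_nonneg ha.le N.cast_nonneg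
  refine ⟨h3, Nat.floor_le_of_le ?_⟩
  exact mul_le_of_le_one_left N.cast_nonneg hb.le

/-- Convergence of Riemann sums over the lattice of rescaled magnetizations. -/
theorem tendsto_lattice_sum {m : ℝ} (hm : m ∈ Ioo (-1 : ℝ) 1) {F : ℕ → ℕ → ℝ} {G : ℝ → ℝ} {D : ℝ}
    (hD : 0 ≤ D)
    (hF : ∀ N k : ℕ, 0 < N → k ≤ N → |F N k| ≤ D * Real.exp (-|fluctVal m N k|))
    (hlim : ∀ᵐ y : ℝ, ∀ k : ℕ → ℕ, (∀ᶠ N in atTop, k N ≤ N) →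
      Tendsto (fun N => fluctVal m N (k N)) atTop (𝓝 y) →
      Tendsto (fun N => F N (k N)) atTop (𝓝 (G y))) :
    Tendsto (fun N : ℕ => 2 * (N : ℝ) ^ (-(3 / 4) : ℝ) * ∑ k ∈ Finset.range (N + 1), F N k) atTop
      (𝓝 (∫ y, G y)) := by
  have hcell : Tendsto (fun N : ℕ => 2 * (N : ℝ) ^ (-(3 / 4) : ℝ)) atTop (𝓝 0) := by
    simpa using (tendsto_rpow_neg_natCast (s := 3 / 4) (by norm_num)).const_mul 2
  have hmain : Tendsto (fun N : ℕ => ∫ y, stepFn m N (F N) y) atTop (𝓝 (∫ y, G y)) := by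
    -- The factor exp 2 pays for replacing the lattice point by y: they differ by at most the mesh,
    -- which is at most 2.
    refine tendsto_integral_filter_of_dominated_convergence
      (fun y => D * Real.exp 2 * Real.exp (-|y|)) ?_ ?_ (integrable_exp_neg_abs.const_mul _) ?_
    · refine Eventually.of_forall fun N => Measurable.aestronglyMeasurable ?_
      exact Finset.measurable_sum _ fun k _ => measurable_const.indicator measurableSet_Ico
    · filter_upwards [eventually_gt_atTop 0] with N hN
      refine Eventually.of_forall fun y => ?_
      by_cases h : 0 ≤ levelOf m N y ∧ ⌊levelOf m N y⌋₊ ≤ N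
      · rw [stepFn_of_mem hN _ h.1 h.2, Real.norm_eq_abs]
        refine (hF N _ hN h.2).trans ?_
        rw [mul_assoc, ← Real.exp_add]
        gcongr
        have h1 := abs_fluctVal_sub_le hN h.1
        have h2 : (N : ℝ) ^ (-(3 / 4) : ℝ) ≤ 1 :=
          Real.rpow_le_one_of_one_le_of_nonpos (by exact_mod_cast hN) (by norm_num)
        have h3 := abs_sub_abs_le_abs_sub y (fluctVal m N ⌊levelOf m N y⌋₊)
        rw [abs_sub_comm] at h3
        linarith
      · rw [stepFn_of_not_mem hN _ h, norm_zero]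
        positivity
    · filter_upwards [hlim] with y hy
      have hev := eventually_levelOf hm y
      refine (hy (fun N => ⌊levelOf m N y⌋₊) (hev.mono fun N h => h.2) ?_).congr' ?_
      · rw [tendsto_iff_norm_sub_tendsto_zero]
        refine squeeze_zero' (Eventually.of_forall fun N => norm_nonneg _) ?_ hcell
        filter_upwards [hev, eventually_gt_atTop 0] with N h hN
        exact abs_fluctVal_sub_le hN h.1
      · filter_upwards [hev, eventually_gt_atTop 0] with N h hN
        exact (stepFn_of_mem hN _ h.1 h.2).symm
  refine hmain.congr' ?_
  filter_upwards [eventually_gt_atTop 0] with N hN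
  exact integral_stepFn m hN (F N)

theorem exists_exp_mul_abs_sub_quartic_le (K : ℝ) {c : ℝ} (hc : 0 < c) :
    ∃ B, ∀ w : ℝ, K * |w| - c * w ^ 4 ≤ B := by
  -- K|w| is first bounded by (K² + w²)/2, then w²/2 by completing the square in w².
  refine ⟨K ^ 2 / 2 + 1 / (16 * c), fun w => ?_⟩
  have h1 : K * |w| ≤ K ^ 2 / 2 + w ^ 2 / 2 := by nlinarith [sq_nonneg (K - |w|), sq_abs w]
  have h2 : w ^ 2 / 2 ≤ c * w ^ 4 + 1 / (16 * c) := by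
    have : c * w ^ 4 + 1 / (16 * c) - w ^ 2 / 2 = c * (w ^ 2 - 1 / (4 * c)) ^ 2 := by
      field_simp
      ring
    nlinarith [mul_nonneg hc.le (sq_nonneg (w ^ 2 - 1 / (4 * c)))]
  linarith

theorem exists_exp_quartic_le (K : ℝ) {c : ℝ} (hc : 0 < c) :
    ∃ B > 0, ∀ w : ℝ, Real.exp (K * |w|) * Real.exp (-c * w ^ 4) ≤ B * Real.exp (-|w|) := by
  obtain ⟨B, hB⟩ := exists_exp_mul_abs_sub_quartic_le (K + 1) hc
  refine ⟨Real.exp B, Real.exp_pos _, fun w => ?_⟩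
  rw [← Real.exp_add, ← Real.exp_add, Real.exp_le_exp]
  linarith [hB w]

/-- Limits of sums of test functions against the level weights of the Curie-Weiss model at a
special point. -/
theorem exists_tendsto_levelWeight_sum {p : ℕ} {β h m : ℝ} (hp : 3 ≤ p)
    (hm : IsUniqueGlobalMax p β h m) (h2 : iteratedDeriv 2 (H p β h) m = 0) :
    ∃ K₀ > 0, ∀ (φ : ℕ → ℝ → ℝ) (ψ : ℝ → ℝ) (K : ℝ),
      (∀ N w, |φ N w| ≤ Real.exp (K * |w|)) →
      (∀ᵐ y : ℝ, ∀ w : ℕ → ℝ, Tendsto w atTop (𝓝 y) →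
        Tendsto (fun N => φ N (w N)) atTop (𝓝 (ψ y))) →
      Tendsto (fun N : ℕ => 2 * (N : ℝ) ^ (-(3 / 4) : ℝ) *
          ∑ k ∈ Finset.range (N + 1), φ N (fluctVal m N k) * levelWeight p β h m N k) atTop
        (𝓝 (K₀ * ∫ y, ψ y * Real.exp (iteratedDeriv 4 (H p β h) m / 24 * y ^ 4))) := by
  obtain ⟨c, hc, hH⟩ := hm.exists_quartic_bound h2 (hm.iteratedDeriv_four_neg hp h2)
  obtain ⟨C, hC, hbound⟩ := exists_levelWeight_bound hm.1 hc hH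
  have hmpos := one_sub_sq_pos_of_mem hm.1
  have hpi := Real.sqrt_pos.2 Real.pi_pos
  refine ⟨√Real.pi / (√Real.pi * √Real.pi) * √(2 / (1 - m ^ 2)), by positivity,
    fun φ ψ K hφ hlim => ?_⟩
  obtain ⟨B, hB, hBexp⟩ := exists_exp_quartic_le K (half_pos hc)
  rw [← integral_const_mul]
  refine tendsto_lattice_sum hm.1 (D := C * B) (by positivity) (fun N k hN hk => ?_) ?_
  · rw [abs_mul, abs_of_nonneg (levelWeight_nonneg p β h m N k)]
    calc _ ≤ Real.exp (K * |fluctVal m N k|) * (C * Real.exp (-(c / 2) * fluctVal m N k ^ 4)) := by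
          gcongr
          · exact levelWeight_nonneg p β h m N k
          · exact hφ _ _
          · exact hbound N k hN hk
      _ = C * (Real.exp (K * |fluctVal m N k|) * Real.exp (-(c / 2) * fluctVal m N k ^ 4)) := by
          ring
      _ ≤ C * (B * Real.exp (-|fluctVal m N k|)) := by
          exact mul_le_mul_of_nonneg_left (hBexp _) hC.le
      _ = _ := by ring
  · filter_upwards [hlim] with y hy k hkN hk
    have := (hy _ hk).mul (tendsto_levelWeight hm h2 hkN hk)
    rwa [mul_left_comm] at this


/-! ### Expectations under the model and their limits -/

/-- The total magnetization of a configuration. -/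
def mag {N : ℕ} (x : Config N) : ℝ := ∑ i, spin x i

/-- The centred and rescaled magnetization of a configuration. -/
def fluct (m : ℝ) {N : ℕ} (x : Config N) : ℝ := (N : ℝ) ^ (1 / 4 : ℝ) * (mag x / N - m)

theorem sum_config_eq_sum_range (N : ℕ) (F : ℝ → ℝ) :
    ∑ x : Config N, F (mag x) = ∑ k ∈ Finset.range (N + 1), N.choose k * F (2 * k - N) := by
  classical
  -- A configuration is encoded by its set of up spins.
  let e : Finset (Fin N) → Config N := fun s i => if i ∈ s then 1 else -1
  have he : Function.Bijective e := by
    constructor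
    · intro s t hst
      ext i
      have := congrFun hst i
      by_cases h1 : i ∈ s <;> by_cases h2 : i ∈ t <;> simp [e, h1, h2] at this ⊢
    · intro x
      refine ⟨Finset.univ.filter fun i => x i = 1, ?_⟩
      ext i
      rcases Int.units_eq_one_or (x i) with h | h <;> simp [e, h]
  have hmag : ∀ s, mag (e s) = 2 * (s.card : ℝ) - N := by
    intro s
    have : ∀ i, spin (e s) i = 2 * (if i ∈ s then 1 else 0) - 1 := by
      intro i
      by_cases h : i ∈ s <;> simp [spin, e, h]
      norm_num
    simp only [mag, this, Finset.sum_sub_distrib, ← Finset.mul_sum]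
    simp
  rw [← he.sum_comp, ← Finset.powerset_univ]
  simp only [hmag]
  rw [Finset.sum_powerset_apply_card (fun k => F (2 * (k : ℝ) - N))]
  simp

theorem energy_eq {p N : ℕ} (hp : 0 < p) (hN : 0 < N) (β h : ℝ) (x : Config N) :
    energy p N β h x = N * (β * (mag x / N) ^ p + h * (mag x / N)) := by
  have h0 : (N : ℝ) ≠ 0 := by exact_mod_cast hN.ne'
  obtain ⟨k, rfl⟩ : ∃ k, p = k + 1 := ⟨p - 1, by omega⟩
  unfold energy
  rw [← Fintype.sum_pow, ← mag, show k + 1 - 1 = k by omega, div_pow]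
  field_simp
  ring

theorem pmf_eq (p N : ℕ) (β h : ℝ) (x : Config N) :
    pmf p N β h x = Real.exp (energy p N β h x) / ∑ y : Config N, Real.exp (energy p N β h y) := by
  rw [pmf, two_pow_mul_partitionFn]

theorem pmf_pos (p N : ℕ) (β h : ℝ) (x : Config N) : 0 < pmf p N β h x := by
  rw [pmf_eq]
  exact div_pos (Real.exp_pos _) (sum_exp_energy_pos p N β h)

theorem energy_add (p N : ℕ) (β h s : ℝ) (x : Config N) :
    energy p N β (h + s) x = energy p N β h x + s * mag x := by
  unfold energy mag
  ring

theorem sum_exp_energy_mul_eq {p N : ℕ} (hp : 0 < p) (hN : 0 < N) (β h m : ℝ) (φ : ℝ → ℝ) :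
    ∑ x : Config N, φ (fluct m x) * Real.exp (energy p N β h x)
      = 2 ^ N * Real.exp (N * H p β h m) / √N *
        ∑ k ∈ Finset.range (N + 1), φ (fluctVal m N k) * levelWeight p β h m N k := by
  have h0 : (0 : ℝ) < N := by exact_mod_cast hN
  have := sum_config_eq_sum_range N fun s =>
    φ ((N : ℝ) ^ (1 / 4 : ℝ) * (s / N - m)) * Real.exp (N * (β * (s / N) ^ p + h * (s / N)))
  simp only [energy_eq hp hN, fluct]
  rw [this, Finset.mul_sum]
  refine Finset.sum_congr rfl fun k _ => ?_
  unfold fluctVal levelWeight magVal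
  field_simp

/-- The normalization of the level weights cancels, and inserting the mesh makes numerator and
denominator Riemann sums. -/
theorem sum_pmf_mul_eq {p N : ℕ} (hp : 0 < p) (hN : 0 < N) (β h m : ℝ) (φ : ℝ → ℝ) :
    ∑ x : Config N, pmf p N β h x * φ (fluct m x)
      = (2 * (N : ℝ) ^ (-(3 / 4) : ℝ) *
          ∑ k ∈ Finset.range (N + 1), φ (fluctVal m N k) * levelWeight p β h m N k) /
        (2 * (N : ℝ) ^ (-(3 / 4) : ℝ) *
          ∑ k ∈ Finset.range (N + 1), levelWeight p β h m N k) := by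
  have h0 : (0 : ℝ) < N := by exact_mod_cast hN
  have h1 : (0 : ℝ) < (N : ℝ) ^ (-(3 / 4) : ℝ) := Real.rpow_pos_of_pos h0 _
  have e1 := sum_exp_energy_mul_eq hp hN β h m φ
  have e2 := sum_exp_energy_mul_eq hp hN β h m fun _ => 1
  simp only [one_mul] at e2
  have e3 : ∑ x : Config N, pmf p N β h x * φ (fluct m x)
      = (∑ x : Config N, φ (fluct m x) * Real.exp (energy p N β h x))
        / ∑ x : Config N, Real.exp (energy p N β h x) := by
    rw [Finset.sum_div]
    refine Finset.sum_congr rfl fun x _ => ?_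
    rw [pmf_eq]
    ring
  rw [e3, e1, e2, mul_div_mul_left _ _ (by positivity), mul_div_mul_left _ _ (by positivity)]

theorem integrable_mul_exp_quartic {q K : ℝ} (hq : q < 0) {ψ : ℝ → ℝ} (hψ : Measurable ψ)
    (hK : ∀ y, |ψ y| ≤ Real.exp (K * |y|)) :
    Integrable fun y : ℝ => ψ y * Real.exp (q * y ^ 4) := by
  obtain ⟨B, hB, h⟩ := exists_exp_quartic_le K (neg_pos.2 hq)
  refine (integrable_exp_neg_abs.const_mul B).mono'
    (Measurable.aestronglyMeasurable (by fun_prop)) (Eventually.of_forall fun y => ?_)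
  rw [norm_mul, Real.norm_eq_abs, Real.norm_eq_abs, Real.abs_exp]
  refine (mul_le_mul_of_nonneg_right (hK y) (Real.exp_pos _).le).trans ?_
  simpa using h y

theorem integral_exp_quartic_pos {q : ℝ} (hq : q < 0) (t : ℝ) :
    0 < ∫ y : ℝ, Real.exp (t * y) * Real.exp (q * y ^ 4) := by
  simp only [← Real.exp_add]
  refine integral_exp_pos ?_
  simp only [Real.exp_add]
  refine integrable_mul_exp_quartic (K := |t|) hq (by fun_prop) fun y => ?_
  rw [Real.abs_exp, Real.exp_le_exp, ← abs_mul]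
  exact le_abs_self _

/-- The fluctuations of the magnetization at a special point, tested against test functions of at
most exponential growth. -/
theorem tendsto_sum_pmf_mul {p : ℕ} {β h m : ℝ} (hp : 3 ≤ p)
    (hm : IsUniqueGlobalMax p β h m) (h2 : iteratedDeriv 2 (H p β h) m = 0)
    (φ : ℕ → ℝ → ℝ) (ψ : ℝ → ℝ) (K : ℝ)
    (hφ : ∀ N w, |φ N w| ≤ Real.exp (K * |w|))
    (hlim : ∀ᵐ y : ℝ, ∀ w : ℕ → ℝ, Tendsto w atTop (𝓝 y) →
        Tendsto (fun N => φ N (w N)) atTop (𝓝 (ψ y))) :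
    Tendsto (fun N : ℕ => ∑ x : Config N, pmf p N β h x * φ N (fluct m x)) atTop
      (𝓝 ((∫ y, ψ y * Real.exp (iteratedDeriv 4 (H p β h) m / 24 * y ^ 4)) /
        ∫ y, Real.exp (iteratedDeriv 4 (H p β h) m / 24 * y ^ 4))) := by
  have hq : iteratedDeriv 4 (H p β h) m / 24 < 0 := by
    linarith [hm.iteratedDeriv_four_neg hp h2]
  obtain ⟨K₀, hK₀, hsum⟩ := exists_tendsto_levelWeight_sum hp hm h2
  have h1 := hsum φ ψ K hφ hlim
  -- The constant test function gives the partition function, and the constant `K₀` cancels in the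
  -- quotient.
  have h3 := hsum (fun _ _ => 1) (fun _ => 1) 0 (by simp)
    (Eventually.of_forall fun _ _ _ => tendsto_const_nhds)
  simp only [one_mul] at h3
  have hpos : 0 < ∫ y : ℝ, Real.exp (iteratedDeriv 4 (H p β h) m / 24 * y ^ 4) := by
    simpa using integral_exp_quartic_pos hq 0
  have := h1.div h3 (by positivity)
  rw [mul_div_mul_left _ _ hK₀.ne'] at this
  refine this.congr' ?_
  filter_upwards [eventually_gt_atTop 0] with N hN
  exact (sum_pmf_mul_eq (by omega) hN β h m (φ N)).symm

/-- Changing the field by `t N^(-3/4)` tilts the law of the fluctuations by `exp (t w)`. -/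
theorem sum_pmf_tilt_mul_eq {N : ℕ} (hN : 0 < N) (p : ℕ) (β h m t : ℝ) (φ : ℝ → ℝ) :
    ∑ x : Config N, pmf p N β (h + t * (N : ℝ) ^ (-(3 / 4) : ℝ)) x * φ (fluct m x)
      = (∑ x : Config N, pmf p N β h x * (φ (fluct m x) * Real.exp (t * fluct m x)))
        / ∑ x : Config N, pmf p N β h x * Real.exp (t * fluct m x) := by
  have h0 : (0 : ℝ) < N := by exact_mod_cast hN
  -- The contribution of centring at m; it is the same for all configurations and cancels.
  set A := Real.exp (t * (N : ℝ) ^ (1 / 4 : ℝ) * m) with hA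
  have hApos : 0 < A := Real.exp_pos _
  have he : ∀ x : Config N, Real.exp (energy p N β (h + t * (N : ℝ) ^ (-(3 / 4) : ℝ)) x)
      = A * (Real.exp (energy p N β h x) * Real.exp (t * fluct m x)) := by
    intro x
    rw [energy_add, hA, ← Real.exp_add, ← Real.exp_add]
    congr 1
    have : (N : ℝ) ^ (1 / 4 : ℝ) = (N : ℝ) ^ (-(3 / 4) : ℝ) * N := by
      rw [← Real.rpow_add_one h0.ne']
      norm_num
    unfold fluct
    rw [this]
    field_simp
    ring
  have hZ := sum_exp_energy_pos p N β h
  set Z := ∑ y : Config N, Real.exp (energy p N β h y) with hZdef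
  simp only [pmf_eq, he, ← Finset.mul_sum, ← hZdef, div_mul_eq_mul_div, ← Finset.sum_div]
  rw [div_div_div_cancel_right₀ hZ.ne']
  simp only [mul_assoc, ← Finset.mul_sum]
  rw [mul_div_mul_left _ _ hApos.ne']
  congr 1
  refine Finset.sum_congr rfl fun x _ => ?_
  ring

theorem abs_mul_exp_le (t w : ℝ) : |w * Real.exp (t * w)| ≤ Real.exp ((1 + |t|) * |w|) := by
  rw [abs_mul, Real.abs_exp, add_mul, one_mul, Real.exp_add]
  refine mul_le_mul (by linarith [Real.add_one_le_exp |w|]) (Real.exp_le_exp.2 ?_)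
    (Real.exp_pos _).le (Real.exp_pos _).le
  rw [← abs_mul]
  exact le_abs_self _

theorem abs_exp_le (t w : ℝ) : |Real.exp (t * w)| ≤ Real.exp (|t| * |w|) := by
  rw [Real.abs_exp, Real.exp_le_exp, ← abs_mul]
  exact le_abs_self _

theorem tendsto_sum_pmf_tilt_fluct {p : ℕ} {β h m : ℝ} (hp : 3 ≤ p)
    (hm : IsUniqueGlobalMax p β h m) (h2 : iteratedDeriv 2 (H p β h) m = 0) (t : ℝ) :
    Tendsto (fun N : ℕ =>
        ∑ x : Config N, pmf p N β (h + t * (N : ℝ) ^ (-(3 / 4) : ℝ)) x * fluct m x) atTop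
      (𝓝 ((∫ y, y * Real.exp (t * y) * Real.exp (iteratedDeriv 4 (H p β h) m / 24 * y ^ 4)) /
        ∫ y, Real.exp (t * y) * Real.exp (iteratedDeriv 4 (H p β h) m / 24 * y ^ 4))) := by
  have hq : iteratedDeriv 4 (H p β h) m / 24 < 0 := by
    linarith [hm.iteratedDeriv_four_neg hp h2]
  have h1 := tendsto_sum_pmf_mul hp hm h2 (fun _ w => w * Real.exp (t * w))
    (fun w => w * Real.exp (t * w)) _ (fun _ w => abs_mul_exp_le t w)
    (Eventually.of_forall fun y w hw =>
      ((show Continuous fun w : ℝ => w * Real.exp (t * w) by fun_prop).tendsto y).comp hw)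
  have h3 := tendsto_sum_pmf_mul hp hm h2 (fun _ w => Real.exp (t * w))
    (fun w => Real.exp (t * w)) _ (fun _ w => abs_exp_le t w)
    (Eventually.of_forall fun y w hw =>
      ((show Continuous fun w : ℝ => Real.exp (t * w) by fun_prop).tendsto y).comp hw)
  have hpos0 : 0 < ∫ y : ℝ, Real.exp (iteratedDeriv 4 (H p β h) m / 24 * y ^ 4) := by
    simpa using integral_exp_quartic_pos hq 0
  have hpos := integral_exp_quartic_pos hq t
  have := h1.div h3 (by positivity)
  rw [div_div_div_cancel_right₀ hpos0.ne'] at this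
  refine this.congr' ?_
  filter_upwards [eventually_gt_atTop 0] with N hN
  exact (sum_pmf_tilt_mul_eq hN p β h m t id).symm


/-! ### The likelihood equation -/

/-- The expectation of the total magnetization. -/
def meanMag (p N : ℕ) (β θ : ℝ) : ℝ := ∑ x : Config N, pmf p N β θ x * mag x

theorem hasDerivAt_exp_energy (p N : ℕ) (β θ : ℝ) (x : Config N) :
    HasDerivAt (fun θ => Real.exp (energy p N β θ x)) (Real.exp (energy p N β θ x) * mag x) θ := by
  unfold energy
  exact (((hasDerivAt_mul_const (mag x)).const_add _).exp)

theorem hasDerivAt_pmf (p N : ℕ) (β θ : ℝ) (x : Config N) :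
    HasDerivAt (fun θ => pmf p N β θ x) (pmf p N β θ x * (mag x - meanMag p N β θ)) θ := by
  have hZ := sum_exp_energy_pos p N β θ
  have h1 := (hasDerivAt_exp_energy p N β θ x).div
    (HasDerivAt.fun_sum fun (y : Config N) (_ : y ∈ Finset.univ) =>
      hasDerivAt_exp_energy p N β θ y) hZ.ne'
  have h2 : meanMag p N β θ = (∑ y : Config N, Real.exp (energy p N β θ y) * mag y)
      / ∑ y : Config N, Real.exp (energy p N β θ y) := by
    unfold meanMag
    rw [Finset.sum_div]
    refine Finset.sum_congr rfl fun y _ => ?_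
    rw [pmf_eq]
    ring
  refine (h1.congr_deriv ?_).congr_of_eventuallyEq (Eventually.of_forall fun θ => ?_)
  · rw [h2, pmf_eq]
    field_simp
  · simp [pmf_eq]

theorem meanMag_eq_of_isMaxOn {p N : ℕ} {β θ : ℝ} {x : Config N}
    (h : IsMaxOn (fun h' => pmf p N β h' x) univ θ) : meanMag p N β θ = mag x := by
  have h1 : IsLocalMax (fun h' => pmf p N β h' x) θ := h.isLocalMax univ_mem
  have h2 := h1.hasDerivAt_eq_zero (hasDerivAt_pmf p N β θ x)
  rcases mul_eq_zero.1 h2 with h3 | h3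
  · exact absurd h3 (pmf_pos p N β θ x).ne'
  · linarith

theorem mag_const_one (N : ℕ) : mag (fun _ : Fin N => (1 : ℤˣ)) = N := by
  simp [mag, spin]

theorem mag_const_neg_one (N : ℕ) : mag (fun _ : Fin N => (-1 : ℤˣ)) = -N := by
  simp [mag, spin]

/-- The mean of an exponentially tilted weight is strictly increasing in the tilt. -/
theorem tilted_mean_lt {α : Type*} [Fintype α] (a S : α → ℝ) (ha : ∀ x, 0 < a x) {x₀ y₀ : α}
    (hS : S x₀ ≠ S y₀) {s : ℝ} (hs : 0 < s) :
    (∑ x, a x * S x) / ∑ x, a x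
      < (∑ x, a x * Real.exp (s * S x) * S x) / ∑ x, a x * Real.exp (s * S x) := by
  have : Nonempty α := ⟨x₀⟩
  have hA : 0 < ∑ x, a x := Finset.sum_pos (fun x _ => ha x) Finset.univ_nonempty
  have hB : 0 < ∑ x, a x * Real.exp (s * S x) :=
    Finset.sum_pos (fun x _ => mul_pos (ha x) (Real.exp_pos _)) Finset.univ_nonempty
  rw [div_lt_div_iff₀ hA hB, ← sub_pos]
  -- Chebyshev's correlation argument: twice the difference of the cross products is a double sum of
  -- these terms, nonnegative because S and exp(sS) are ordered alike.
  have hterm : ∀ x y, 0 ≤ a x * a y * ((S x - S y) * (Real.exp (s * S x) - Real.exp (s * S y))) := by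
    intro x y
    refine mul_nonneg (mul_pos (ha x) (ha y)).le ?_
    rcases le_total (S x) (S y) with h | h
    · exact mul_nonneg_of_nonpos_of_nonpos (sub_nonpos.2 h)
        (sub_nonpos.2 (Real.exp_le_exp.2 (by gcongr)))
    · exact mul_nonneg (sub_nonneg.2 h) (sub_nonneg.2 (Real.exp_le_exp.2 (by gcongr)))
  have hterm0 : 0 < a x₀ * a y₀ *
      ((S x₀ - S y₀) * (Real.exp (s * S x₀) - Real.exp (s * S y₀))) := by
    refine mul_pos (mul_pos (ha x₀) (ha y₀)) ?_
    rcases lt_or_gt_of_ne hS with h | h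
    · exact mul_pos_of_neg_of_neg (sub_neg.2 h)
        (sub_neg.2 (Real.exp_lt_exp.2 (by gcongr)))
    · exact mul_pos (sub_pos.2 h) (sub_pos.2 (Real.exp_lt_exp.2 (by gcongr)))
  have hpos : 0 < ∑ x, ∑ y, a x * a y *
      ((S x - S y) * (Real.exp (s * S x) - Real.exp (s * S y))) := by
    refine Finset.sum_pos' (fun x _ => Finset.sum_nonneg fun y _ => hterm x y)
      ⟨x₀, Finset.mem_univ _, ?_⟩
    exact Finset.sum_pos' (fun y _ => hterm x₀ y) ⟨y₀, Finset.mem_univ _, hterm0⟩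
  have hexpand : ∑ x, ∑ y, a x * a y *
      ((S x - S y) * (Real.exp (s * S x) - Real.exp (s * S y)))
      = 2 * ((∑ x, a x * Real.exp (s * S x) * S x) * (∑ x, a x)
        - (∑ x, a x * S x) * ∑ x, a x * Real.exp (s * S x)) := by
    have e : ∀ x y, a x * a y * ((S x - S y) * (Real.exp (s * S x) - Real.exp (s * S y)))
        = (a x * Real.exp (s * S x) * S x) * a y + a x * (a y * Real.exp (s * S y) * S y)
          - (a x * S x) * (a y * Real.exp (s * S y))
          - (a x * Real.exp (s * S x)) * (a y * S y) := fun x y => by ring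
    simp only [e, Finset.sum_sub_distrib, Finset.sum_add_distrib, ← Finset.sum_mul_sum]
    ring
  rw [hexpand] at hpos
  linarith

theorem strictMono_meanMag (p : ℕ) {N : ℕ} (hN : 0 < N) (β : ℝ) : StrictMono (meanMag p N β) := by
  intro θ₁ θ₂ hlt
  have key : ∀ θ, meanMag p N β θ = (∑ x : Config N, Real.exp (energy p N β θ x) * mag x)
      / ∑ x : Config N, Real.exp (energy p N β θ x) := by
    intro θ
    unfold meanMag
    rw [Finset.sum_div]
    refine Finset.sum_congr rfl fun y _ => ?_
    rw [pmf_eq]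
    ring
  have hne : mag (fun _ : Fin N => (1 : ℤˣ)) ≠ mag (fun _ : Fin N => (-1 : ℤˣ)) := by
    rw [mag_const_one, mag_const_neg_one]
    have : (0 : ℝ) < N := by exact_mod_cast hN
    linarith
  have := tilted_mean_lt (fun x : Config N => Real.exp (energy p N β θ₁ x)) mag
    (fun x => Real.exp_pos _) hne (sub_pos.2 hlt)
  rw [key, key]
  simpa only [← Real.exp_add, ← energy_add, add_sub_cancel] using this

/-- Only the term of y is kept in the partition function. With y a constant configuration this gives
decay as θ → ±∞. -/
theorem pmf_le_exp (p N : ℕ) (β θ : ℝ) (x y : Config N) :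
    pmf p N β θ x ≤ Real.exp (energy p N β 0 x - energy p N β 0 y + θ * (mag x - mag y)) := by
  have h1 : ∀ z : Config N, energy p N β θ z = energy p N β 0 z + θ * mag z := fun z => by
    rw [← energy_add, zero_add]
  rw [pmf_eq, show energy p N β 0 x - energy p N β 0 y + θ * (mag x - mag y)
    = energy p N β θ x - energy p N β θ y by rw [h1, h1]; ring, Real.exp_sub]
  refine div_le_div_of_nonneg_left (Real.exp_pos _).le (Real.exp_pos _) ?_
  exact Finset.single_le_sum (f := fun y => Real.exp (energy p N β θ y))
    (fun z _ => (Real.exp_pos _).le) (Finset.mem_univ y)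

/-- The likelihood is continuous, positive and vanishes at ±∞, because the magnetization lies
strictly between its extremes ±N. -/
theorem exists_isMaxOn_pmf (p : ℕ) {N : ℕ} (β : ℝ) {x : Config N} (hx : |mag x| < N) :
    ∃ θ : ℝ, IsMaxOn (fun h' => pmf p N β h' x) univ θ := by
  obtain ⟨hx1, hx2⟩ := abs_lt.1 hx
  have hcont : Continuous fun θ => pmf p N β θ x :=
    continuous_iff_continuousAt.2 fun θ => (hasDerivAt_pmf p N β θ x).continuousAt
  have hlim : Tendsto (fun θ => pmf p N β θ x) (cocompact ℝ) (𝓝 0) := by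
    rw [cocompact_eq_atBot_atTop, tendsto_sup]
    constructor
    · refine squeeze_zero (fun θ => pmf_nonneg p N β θ x)
        (fun θ => pmf_le_exp p N β θ x fun _ => -1) ?_
      refine Real.tendsto_exp_atBot.comp (tendsto_atBot_add_const_left _ _ ?_)
      refine tendsto_id.atBot_mul_const ?_
      rw [mag_const_neg_one]
      linarith
    · refine squeeze_zero (fun θ => pmf_nonneg p N β θ x)
        (fun θ => pmf_le_exp p N β θ x fun _ => 1) ?_
      refine Real.tendsto_exp_atBot.comp (tendsto_atBot_add_const_left _ _ ?_)
      refine tendsto_id.atTop_mul_const_of_neg ?_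
      rw [mag_const_one]
      linarith
  obtain ⟨θ, hθ⟩ := hcont.exists_forall_ge' 0
    ((hlim.eventually (gt_mem_nhds (pmf_pos p N β 0 x))).mono fun _ h => h.le)
  exact ⟨θ, fun θ' _ => hθ θ'⟩

/-- The maximum likelihood estimate is at most `θ` exactly if the observed magnetization is at most
its expectation under `θ`. -/
theorem IsFieldMLE.le_iff {p N : ℕ} {β : ℝ} {est : Config N → ℝ} (hest : IsFieldMLE p N β est)
    {x : Config N} (hx : |mag x| < N) (θ : ℝ) : est x ≤ θ ↔ mag x ≤ meanMag p N β θ := by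
  have hN : 0 < N := by
    have := (abs_nonneg _).trans_lt hx
    exact_mod_cast this
  rw [← meanMag_eq_of_isMaxOn (hest x (exists_isMaxOn_pmf p β hx)),
    (strictMono_meanMag p hN β).le_iff_le]

theorem sum_pmf_mul_fluct {N : ℕ} (p : ℕ) (β θ m : ℝ) :
    ∑ x : Config N, pmf p N β θ x * fluct m x
      = (N : ℝ) ^ (1 / 4 : ℝ) * (meanMag p N β θ / N - m) := by
  have : ∀ x : Config N, pmf p N β θ x * fluct m x
      = (N : ℝ) ^ (1 / 4 : ℝ) / N * (pmf p N β θ x * mag x)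
        - (N : ℝ) ^ (1 / 4 : ℝ) * m * pmf p N β θ x := fun x => by
    unfold fluct
    ring
  simp only [this, Finset.sum_sub_distrib, ← Finset.mul_sum, sum_pmf]
  rw [← meanMag]
  ring

/-- Both sides of the likelihood comparison are centred at the same m and scaled by N^(1/4), which
preserves the inequality. -/
theorem IsFieldMLE.scaled_le_iff {p N : ℕ} {β : ℝ} {est : Config N → ℝ}
    (hest : IsFieldMLE p N β est) {x : Config N} (hx : |mag x| < N) (h m t : ℝ) :
    (N : ℝ) ^ (3 / 4 : ℝ) * (est x - h) ≤ t ↔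
      fluct m x ≤ ∑ y : Config N, pmf p N β (h + t * (N : ℝ) ^ (-(3 / 4) : ℝ)) y * fluct m y := by
  have hN : (0 : ℝ) < N := (abs_nonneg _).trans_lt hx
  have h1 : 0 < (N : ℝ) ^ (3 / 4 : ℝ) := Real.rpow_pos_of_pos hN _
  have h2 : 0 < (N : ℝ) ^ (1 / 4 : ℝ) := Real.rpow_pos_of_pos hN _
  rw [sum_pmf_mul_fluct, fluct, mul_le_mul_iff_right₀ h2, sub_le_sub_iff_right,
    div_le_div_iff_of_pos_right hN, ← hest.le_iff hx, Real.rpow_neg hN.le, ← div_eq_mul_inv,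
    ← le_div_iff₀' h1, sub_le_iff_le_add']


/-! ### Means of exponential tilts and the law G_1 -/

section TiltedMean

variable {ν : Measure ℝ}

theorem continuous_cdf (ν : Measure ℝ) [IsProbabilityMeasure ν] [NullSingletonClass ν] :
    Continuous (cdf ν) := by
  refine continuous_iff_continuousAt.2 fun a => ?_
  rw [(monotone_cdf ν).continuousAt_iff_leftLim_eq_rightLim, StieltjesFunction.rightLim_eq]
  have h1 := (cdf ν).measure_singleton a
  rw [measure_cdf, measure_singleton, eq_comm, ENNReal.ofReal_eq_zero] at h1
  exact le_antisymm ((monotone_cdf ν).leftLim_le le_rfl) (by linarith)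

theorem mem_interior_integrableExpSet (hexp : ∀ t : ℝ, Integrable (fun x => Real.exp (t * x)) ν)
    (t : ℝ) : t ∈ interior (integrableExpSet id ν) := by
  have : integrableExpSet id ν = univ := eq_univ_of_forall fun t => hexp t
  rw [this, interior_univ]
  exact mem_univ t

theorem differentiable_cgf (hexp : ∀ t : ℝ, Integrable (fun x => Real.exp (t * x)) ν) :
    Differentiable ℝ (cgf id ν) := fun t =>
  (analyticAt_cgf (mem_interior_integrableExpSet hexp t)).differentiableAt

theorem differentiable_deriv_cgf (hexp : ∀ t : ℝ, Integrable (fun x => Real.exp (t * x)) ν) :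
    Differentiable ℝ (deriv (cgf id ν)) := fun t =>
  (analyticAt_cgf (mem_interior_integrableExpSet hexp t)).deriv.differentiableAt

/-- The second derivative of the cumulant generating function is the variance of the tilted law. -/
theorem monotone_deriv_cgf (hexp : ∀ t : ℝ, Integrable (fun x => Real.exp (t * x)) ν) :
    Monotone (deriv (cgf id ν)) := by
  refine monotone_of_deriv_nonneg (differentiable_deriv_cgf hexp) fun t => ?_
  rw [← iteratedDeriv_one (f := cgf id ν), ← iteratedDeriv_succ,
    ← variance_tilted_mul (mem_interior_integrableExpSet hexp t)]
  exact variance_nonneg _ _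

theorem exists_cgf_sub_eq (hexp : ∀ t : ℝ, Integrable (fun x => Real.exp (t * x)) ν) {s t : ℝ}
    (hst : s < t) : ∃ r ∈ Ioo s t, cgf id ν t - cgf id ν s = deriv (cgf id ν) r * (t - s) := by
  obtain ⟨r, hr, h⟩ := exists_deriv_eq_slope (cgf id ν) hst
    (differentiable_cgf hexp).continuous.continuousOn (differentiable_cgf hexp).differentiableOn
  refine ⟨r, hr, ?_⟩
  rw [h, div_mul_cancel₀ _ (sub_pos.2 hst).ne']

theorem measureReal_pos_of_volume_ne_zero [IsProbabilityMeasure ν] (hac : volume ≪ ν) {s : Set ℝ}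
    (hs : volume s ≠ 0) : 0 < ν.real s :=
  ENNReal.toReal_pos (fun h => hs (hac h)) (measure_ne_top _ _)

/-- If the derivative stayed below B, the cumulant generating function would be at most Bt for t >
0, and Chernoff's bound would give [B + 1, ∞) mass at most exp(-t) for every such t. This is
impossible, as ν charges every set of positive Lebesgue measure. -/
theorem tendsto_deriv_cgf_atTop [IsProbabilityMeasure ν] (hac : volume ≪ ν)
    (hexp : ∀ t : ℝ, Integrable (fun x => Real.exp (t * x)) ν) :
    Tendsto (deriv (cgf id ν)) atTop atTop := by
  refine tendsto_atTop_atTop_of_monotone (monotone_deriv_cgf hexp) fun B => ?_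
  by_contra! hB
  have hpos : 0 < ν.real {x | B + 1 ≤ id x} :=
    measureReal_pos_of_volume_ne_zero hac (by
      rw [show {x : ℝ | B + 1 ≤ id x} = Ici (B + 1) from rfl]; simp)
  have hle : ∀ t : ℝ, 0 < t → ν.real {x | B + 1 ≤ id x} ≤ Real.exp (-t) := by
    intro t ht
    refine (measure_ge_le_exp_cgf (B + 1) ht.le (hexp t)).trans (Real.exp_le_exp.2 ?_)
    obtain ⟨r, -, hr⟩ := exists_cgf_sub_eq hexp ht
    rw [cgf_zero, sub_zero, sub_zero] at hr
    change -t * (B + 1) + cgf id ν t ≤ -t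
    nlinarith [hB r]
  have hlim : Tendsto (fun t : ℝ => Real.exp (-t)) atTop (𝓝 0) := Real.tendsto_exp_neg_atTop_nhds_zero
  obtain ⟨t, ht, ht0⟩ := ((hlim.eventually (gt_mem_nhds hpos)).and (eventually_gt_atTop 0)).exists
  exact absurd (hle t ht0) (not_le.2 ht)

theorem tendsto_deriv_cgf_atBot [IsProbabilityMeasure ν] (hac : volume ≪ ν)
    (hexp : ∀ t : ℝ, Integrable (fun x => Real.exp (t * x)) ν) :
    Tendsto (deriv (cgf id ν)) atBot atBot := by
  refine tendsto_atBot_atBot_of_monotone (monotone_deriv_cgf hexp) fun B => ?_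
  by_contra! hB
  have hpos : 0 < ν.real {x | id x ≤ B - 1} :=
    measureReal_pos_of_volume_ne_zero hac (by
      rw [show {x : ℝ | id x ≤ B - 1} = Iic (B - 1) from rfl]; simp)
  have hle : ∀ t : ℝ, t < 0 → ν.real {x | id x ≤ B - 1} ≤ Real.exp t := by
    intro t ht
    refine (measure_le_le_exp_cgf (B - 1) ht.le (hexp t)).trans (Real.exp_le_exp.2 ?_)
    obtain ⟨r, -, hr⟩ := exists_cgf_sub_eq hexp ht
    rw [cgf_zero, zero_sub, zero_sub] at hr
    change -t * (B - 1) + cgf id ν t ≤ t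
    nlinarith [hB r]
  obtain ⟨t, ht, ht0⟩ := ((Real.tendsto_exp_atBot.eventually (gt_mem_nhds hpos)).and
    (eventually_lt_atBot 0)).exists
  exact absurd (hle t ht0) (not_le.2 ht)

/-- The distribution function of `ν` evaluated at the mean of the exponential tilt of `ν`. -/
def tiltedMeanCdf (ν : Measure ℝ) [IsProbabilityMeasure ν] [NullSingletonClass ν]
    (hexp : ∀ t : ℝ, Integrable (fun x => Real.exp (t * x)) ν) : StieltjesFunction ℝ where
  toFun t := cdf ν (deriv (cgf id ν) t)
  mono' := (monotone_cdf ν).comp (monotone_deriv_cgf hexp)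
  right_continuous' _ :=
    ((continuous_cdf ν).comp (differentiable_deriv_cgf hexp).continuous).continuousWithinAt

theorem exists_measure_tiltedMeanCdf [IsProbabilityMeasure ν] [NullSingletonClass ν] (hac : volume ≪ ν)
    (hexp : ∀ t : ℝ, Integrable (fun x => Real.exp (t * x)) ν) :
    ∃ G : Measure ℝ, IsProbabilityMeasure G ∧ ∀ t, cdf G t = cdf ν (deriv (cgf id ν) t) := by
  have h0 : Tendsto (tiltedMeanCdf ν hexp) atBot (𝓝 0) :=
    (tendsto_cdf_atBot ν).comp (tendsto_deriv_cgf_atBot hac hexp)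
  have h1 : Tendsto (tiltedMeanCdf ν hexp) atTop (𝓝 1) :=
    (tendsto_cdf_atTop ν).comp (tendsto_deriv_cgf_atTop hac hexp)
  refine ⟨(tiltedMeanCdf ν hexp).measure, ⟨?_⟩, fun t => ?_⟩
  · rw [StieltjesFunction.measure_univ _ h0 h1, sub_zero, ENNReal.ofReal_one]
  · rw [cdf_measure_stieltjesFunction _ h0 h1]
    rfl

end TiltedMean

/-! ### Quartic-exponential laws -/

/-- The probability law on `ℝ` with density proportional to `exp (q x ^ 4 + t x)`. -/
def quarticMeasure (q t : ℝ) : Measure ℝ := volume.tilted fun x => q * x ^ 4 + t * x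

theorem quarticLaw_zero_eq (p : ℕ) (β h m t : ℝ) :
    quarticLaw p β h m 0 t = quarticMeasure (iteratedDeriv 4 (H p β h) m / 24) t := by
  have : quarticMeasure (iteratedDeriv 4 (H p β h) m / 24) t
      = volume.tilted fun x =>
        iteratedDeriv 4 (H p β h) m / 24 * x ^ 4 + (0 * p * m ^ (p - 1) + t) * x := by
    simp [quarticMeasure]
  rw [this]
  rfl

section Quartic

variable {q : ℝ}

theorem integrable_exp_quartic (hq : q < 0) (t : ℝ) :
    Integrable fun x : ℝ => Real.exp (q * x ^ 4 + t * x) := by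
  have := integrable_mul_exp_quartic (K := |t|) hq (ψ := fun y => Real.exp (t * y))
    (by fun_prop) (abs_exp_le t)
  simpa only [← Real.exp_add, add_comm] using this

theorem isProbabilityMeasure_quarticMeasure (hq : q < 0) (t : ℝ) :
    IsProbabilityMeasure (quarticMeasure q t) :=
  isProbabilityMeasure_tilted (integrable_exp_quartic hq t)

theorem volume_absolutelyContinuous_quarticMeasure (hq : q < 0) (t : ℝ) :
    volume ≪ quarticMeasure q t :=
  absolutelyContinuous_tilted (integrable_exp_quartic hq t)

theorem nullSingletonClass_quarticMeasure (q t : ℝ) : NullSingletonClass (quarticMeasure q t) :=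
  ⟨fun x => tilted_absolutelyContinuous _ _ (measure_singleton x)⟩

/-- Makes the whole family one exponential family, so that all its means come from a single cumulant
generating function. -/
theorem quarticMeasure_eq_tilted (hq : q < 0) (t : ℝ) :
    quarticMeasure q t = (quarticMeasure q 0).tilted (t * ·) := by
  unfold quarticMeasure
  rw [tilted_tilted (integrable_exp_quartic hq 0)]
  congr 1
  ext x
  simp

theorem integral_quarticMeasure (q t : ℝ) (g : ℝ → ℝ) :
    ∫ x, g x ∂(quarticMeasure q t)
      = (∫ x, g x * (Real.exp (t * x) * Real.exp (q * x ^ 4)))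
        / ∫ x, Real.exp (t * x) * Real.exp (q * x ^ 4) := by
  unfold quarticMeasure
  rw [integral_tilted, ← integral_div]
  simp only [← Real.exp_add, add_comm (q * _), smul_eq_mul]
  congr 1
  ext x
  ring

theorem integrable_exp_mul_quarticMeasure (hq : q < 0) (t : ℝ) :
    Integrable (fun x => Real.exp (t * x)) (quarticMeasure q 0) := by
  unfold quarticMeasure
  rw [integrable_tilted_iff (integrable_exp_quartic hq 0)]
  simpa [← Real.exp_add] using integrable_exp_quartic hq t

theorem integrable_id_quarticMeasure (hq : q < 0) (t : ℝ) :
    Integrable (fun x : ℝ => x) (quarticMeasure q t) := by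
  rw [quarticMeasure_eq_tilted hq]
  have := memLp_tilted_mul
    (mem_interior_integrableExpSet (integrable_exp_mul_quarticMeasure hq) t) 1
  exact memLp_one_iff_integrable.1 this

theorem integral_id_quarticMeasure (hq : q < 0) (t : ℝ) :
    ∫ x, x ∂(quarticMeasure q t) = deriv (cgf id (quarticMeasure q 0)) t := by
  rw [quarticMeasure_eq_tilted hq]
  exact integral_tilted_mul_self
    (mem_interior_integrableExpSet (integrable_exp_mul_quarticMeasure hq) t)

theorem measureReal_quarticMeasure (q t : ℝ) {s : Set ℝ} (hs : MeasurableSet s) :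
    (quarticMeasure q t).real s
      = (∫ x, s.indicator 1 x * (Real.exp (t * x) * Real.exp (q * x ^ 4)))
        / ∫ x, Real.exp (t * x) * Real.exp (q * x ^ 4) := by
  rw [← integral_quarticMeasure, integral_indicator_one hs]

/-! ### Tail comparison with Gaussian laws -/

theorem exists_quarticMeasure_tail_ge (hq : q < 0) :
    ∃ c > 0, ∀ a : ℝ, 0 ≤ a → c * Real.exp (q * (a + 1) ^ 4) ≤ (quarticMeasure q 0).real (Ioi a) := by
  have hZ := integral_exp_quartic_pos hq 0
  refine ⟨1 / ∫ x : ℝ, Real.exp (0 * x) * Real.exp (q * x ^ 4), by positivity, fun a ha => ?_⟩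
  rw [measureReal_quarticMeasure _ _ measurableSet_Ioi, one_div_mul_eq_div]
  refine div_le_div_of_nonneg_right ?_ hZ.le
  have hconst : ∫ x : ℝ, (Ioc a (a + 1)).indicator (fun _ => Real.exp (q * (a + 1) ^ 4)) x
      = Real.exp (q * (a + 1) ^ 4) := by
    rw [integral_indicator measurableSet_Ioc, setIntegral_const, measureReal_def, Real.volume_Ioc]
    simp
  rw [← hconst]
  refine integral_mono ?_ ?_ fun x => ?_
  · exact (integrableOn_const (by simp)).integrable_indicator measurableSet_Ioc
  · have h1 : Integrable fun x : ℝ => Real.exp (0 * x) * Real.exp (q * x ^ 4) := by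
      simpa using integrable_exp_quartic hq 0
    refine (h1.indicator (measurableSet_Ioi (a := a))).congr (Eventually.of_forall fun x => ?_)
    by_cases hx : x ∈ Ioi a <;> simp [hx]
  · by_cases hx : x ∈ Ioc a (a + 1)
    · have hx' : x ∈ Ioi a := hx.1
      simp only [hx, indicator_of_mem, hx', Pi.one_apply, one_mul, zero_mul, Real.exp_zero]
      refine Real.exp_le_exp.2 (mul_le_mul_of_nonpos_left ?_ hq.le)
      exact pow_le_pow_left₀ (ha.trans hx.1.le) hx.2 4
    · rw [indicator_of_notMem hx]
      refine mul_nonneg (indicator_nonneg (fun _ _ => zero_le_one) _) (by positivity)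

/-- A Young-type inequality bounds the tilt 2s³x by a multiple of s⁴ plus half of |q| x⁴; the
remaining half of the quartic exponent keeps the integral finite. -/
theorem exists_cgf_quarticMeasure_le (hq : q < 0) :
    ∃ R L : ℝ, ∀ s : ℝ, 0 ≤ s →
      cgf id (quarticMeasure q 0) (2 * s ^ 3) ≤ R * s ^ 4 + L := by
  -- The threshold is chosen so that for x ≥ rs the tilt, at most (2/r³) x⁴, is absorbed by half of
  -- the quartic; for x ≤ rs it is at most 2r s⁴.
  obtain ⟨r, hr, hr3⟩ : ∃ r : ℝ, 1 ≤ r ∧ 2 / r ^ 3 ≤ -q / 2 := by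
    refine ⟨max 1 (4 / -q), le_max_left _ _, ?_⟩
    have hr := le_max_left 1 (4 / -q)
    set r := max 1 (4 / -q)
    rw [div_le_div_iff₀ (by positivity) two_pos]
    have h1 : 4 ≤ r * -q := by
      rw [← div_le_iff₀ (neg_pos.2 hq)]
      exact le_max_right _ _
    have h2 : r ≤ r ^ 3 := le_self_pow₀ hr (by norm_num)
    nlinarith
  have hyoung : ∀ s x : ℝ, 0 ≤ s → 2 * s ^ 3 * x ≤ 2 * r * s ^ 4 + -q / 2 * x ^ 4 := by
    intro s x hs
    have hr0 : 0 < r := by linarith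
    rcases le_total x (r * s) with hx | hx
    · have h1 : 2 * s ^ 3 * x ≤ 2 * s ^ 3 * (r * s) := by gcongr
      have h2 : 0 ≤ -q / 2 * x ^ 4 := mul_nonneg (by linarith) (by positivity)
      linarith
    · have hx0 : 0 ≤ x := (by positivity : 0 ≤ r * s).trans hx
      have h1 : s ≤ x / r := by rwa [le_div_iff₀' hr0]
      have h2 : 2 * s ^ 3 * x ≤ 2 * (x / r) ^ 3 * x := by gcongr
      have h3 : 2 * (x / r) ^ 3 * x = 2 / r ^ 3 * x ^ 4 := by
        field_simp
      have h4 : 2 / r ^ 3 * x ^ 4 ≤ -q / 2 * x ^ 4 := by gcongr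
      have h5 : 0 ≤ 2 * r * s ^ 4 := by positivity
      linarith
  have := isProbabilityMeasure_quarticMeasure hq 0
  set Z := ∫ x : ℝ, Real.exp (0 * x) * Real.exp (q * x ^ 4) with hZdef
  have hZ : 0 < Z := integral_exp_quartic_pos hq 0
  have hM : 0 < ∫ x : ℝ, Real.exp (0 * x) * Real.exp (q / 2 * x ^ 4) :=
    integral_exp_quartic_pos (by linarith) 0
  set M := ∫ x : ℝ, Real.exp (0 * x) * Real.exp (q / 2 * x ^ 4)
  refine ⟨2 * r, Real.log (M / Z), fun s hs => ?_⟩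
  have hmgf : mgf id (quarticMeasure q 0) (2 * s ^ 3) ≤ Real.exp (2 * r * s ^ 4) * (M / Z) := by
    unfold mgf
    rw [integral_quarticMeasure, ← hZdef, mul_div_assoc']
    refine div_le_div_of_nonneg_right ?_ hZ.le
    rw [← integral_const_mul]
    refine integral_mono ?_ ?_ fun x => ?_
    · simpa [← Real.exp_add, add_comm] using integrable_exp_quartic hq (2 * s ^ 3)
    · refine Integrable.const_mul ?_ _
      simpa using integrable_exp_quartic (show q / 2 < 0 by linarith) 0
    · simp only [id, ← Real.exp_add, Real.exp_le_exp]
      linarith [hyoung s x hs]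
  have hpos : 0 < mgf id (quarticMeasure q 0) (2 * s ^ 3) :=
    mgf_pos (integrable_exp_mul_quarticMeasure hq _)
  calc cgf id (quarticMeasure q 0) (2 * s ^ 3)
      ≤ Real.log (Real.exp (2 * r * s ^ 4) * (M / Z)) := Real.log_le_log hpos hmgf
    _ = _ := by rw [Real.log_mul (Real.exp_pos _).ne' (by positivity), Real.log_exp]

/-- By convexity the slope at s³ is at most the mean slope over [s³, 2s³], which is O(s) by the s⁴
bound at 2s³ and a linear lower bound at s³. The -1 matches the unit shift in
`exists_quarticMeasure_tail_ge`. -/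
theorem exists_deriv_cgf_quarticMeasure_le (hq : q < 0) :
    ∃ κ : ℝ, 1 ≤ κ ∧ ∀ s : ℝ, 1 ≤ s →
      deriv (cgf id (quarticMeasure q 0)) (s ^ 3) ≤ κ * s - 1 := by
  obtain ⟨R, L, hRL⟩ := exists_cgf_quarticMeasure_le hq
  have hexp := integrable_exp_mul_quarticMeasure hq
  have := isProbabilityMeasure_quarticMeasure hq 0
  set u := deriv (cgf id (quarticMeasure q 0)) with hu
  have hmono : Monotone u := monotone_deriv_cgf hexp
  refine ⟨|R| + |L| + |u 0| + 1, by linarith [abs_nonneg R, abs_nonneg L, abs_nonneg (u 0)],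
    fun s hs => ?_⟩
  have hs3 : 1 ≤ s ^ 3 := one_le_pow₀ hs
  have h0 : 0 < s ^ 3 := by linarith
  obtain ⟨r₁, hr₁, e₁⟩ := exists_cgf_sub_eq hexp h0
  obtain ⟨r₂, hr₂, e₂⟩ := exists_cgf_sub_eq hexp (show s ^ 3 < 2 * s ^ 3 by linarith)
  rw [cgf_zero, sub_zero, sub_zero] at e₁
  have h1 : u 0 ≤ u r₁ := hmono hr₁.1.le
  have h2 : u (s ^ 3) ≤ u r₂ := hmono hr₂.1.le
  have h3 := hRL s (by linarith)
  have h4 : u (s ^ 3) * s ^ 3 + u 0 * s ^ 3 ≤ R * s ^ 4 + L := by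
    have a1 := mul_le_mul_of_nonneg_right h1 h0.le
    have a2 := mul_le_mul_of_nonneg_right h2 h0.le
    rw [show 2 * s ^ 3 - s ^ 3 = s ^ 3 by ring] at e₂
    linarith
  have h5 : R * s ^ 4 + L ≤ (|R| * s + |L|) * s ^ 3 := by
    have a1 : R * s ^ 4 ≤ |R| * s ^ 4 := by gcongr; exact le_abs_self R
    have a2 : L ≤ |L| * s ^ 3 := (le_abs_self L).trans (le_mul_of_one_le_right (abs_nonneg L) hs3)
    linarith
  have h6 : u (s ^ 3) + u 0 ≤ |R| * s + |L| := by
    refine le_of_mul_le_mul_right ?_ h0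
    linarith
  have h7 : |L| ≤ |L| * s := le_mul_of_one_le_right (abs_nonneg L) hs
  have h8 : |u 0| ≤ |u 0| * s := le_mul_of_one_le_right (abs_nonneg _) hs
  have h9 := neg_abs_le (u 0)
  linarith

/-- The law whose distribution function at `t` is that of the quartic law evaluated at the mean of
its tilt by `t` has heavier tails than any Gaussian law. -/
theorem ne_gaussianReal_of_cdf_eq (hq : q < 0) {G : Measure ℝ} [IsProbabilityMeasure G]
    (hG : ∀ t, cdf G t = cdf (quarticMeasure q 0) (deriv (cgf id (quarticMeasure q 0)) t))
    (μ : ℝ) (v : NNReal) : G ≠ gaussianReal μ v := by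
  intro hGauss
  obtain ⟨κ, hκ, hu⟩ := exists_deriv_cgf_quarticMeasure_le hq
  obtain ⟨c, hc, htail⟩ := exists_quarticMeasure_tail_ge hq
  have := isProbabilityMeasure_quarticMeasure hq 0
  have hone : ∀ (P : Measure ℝ) [IsProbabilityMeasure P] (a : ℝ), P.real (Ioi a) = 1 - cdf P a := by
    intro P _ a
    rw [cdf_eq_real, ← compl_Iic, probReal_compl_eq_one_sub measurableSet_Iic]
  have hlower : ∀ s : ℝ, 1 ≤ s → c * Real.exp (q * (κ * s) ^ 4) ≤ G.real (Ioi (s ^ 3)) := by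
    intro s hs
    have h1 := htail (κ * s - 1) (by nlinarith)
    rw [sub_add_cancel] at h1
    refine h1.trans ?_
    rw [hone, hone, hG]
    have := monotone_cdf (quarticMeasure q 0) (hu s hs)
    linarith
  have hupper : ∀ l t : ℝ, 0 ≤ l → G.real (Ioi t) ≤ Real.exp (-l * t + (μ * l + v * l ^ 2 / 2)) := by
    intro l t hl
    have h1 : G.real (Ioi t) ≤ G.real {x | t ≤ id x} :=
      measureReal_mono fun x (hx : t < x) => hx.le
    refine h1.trans ?_
    subst hGauss
    refine (measure_ge_le_exp_mul_mgf t hl (integrable_exp_mul_gaussianReal l)).trans ?_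
    rw [mgf_fun_id_gaussianReal, ← Real.exp_add]
  -- With Chernoff parameter As at the point s³, the Gaussian exponent is -As⁴ + O(s²), which beats
  -- the lower exponent q κ⁴ s⁴ by s⁴.
  set A := -q * κ ^ 4 + 1 with hA
  have hA0 : 0 ≤ A := by
    have : 0 ≤ -q * κ ^ 4 := mul_nonneg (by linarith) (by positivity)
    linarith
  have hall : ∀ s : ℝ, 1 ≤ s → Real.log c ≤ -s ^ 4 + (μ * A) * s + (v * A ^ 2 / 2) * s ^ 2 := by
    intro s hs
    have h1 := (hlower s hs).trans (hupper (A * s) (s ^ 3) (by positivity))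
    rw [← Real.exp_log hc, ← Real.exp_add, Real.exp_le_exp] at h1
    have : q * (κ * s) ^ 4 = -(A - 1) * s ^ 4 := by rw [hA]; ring
    rw [this] at h1
    linarith
  set b := |μ * A| with hb
  set d := (v * A ^ 2 / 2 : ℝ) with hd
  have hd0 : 0 ≤ d := by positivity
  have hb0 : 0 ≤ b := abs_nonneg _
  have hl0 := abs_nonneg (Real.log c)
  -- Large enough that s² - b - d ≥ 1 + |log c|, which contradicts `hall`.
  set s := 1 + b + d + |Real.log c| with hs
  have hs1 : 1 ≤ s := by linarith
  have h1 := hall s hs1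
  have h2 : μ * A * s ≤ b * s ^ 2 := by
    calc μ * A * s ≤ b * s := by gcongr; exact le_abs_self _
      _ ≤ b * s ^ 2 := by gcongr; exact le_self_pow₀ hs1 two_ne_zero
  have h3 : s ≤ s ^ 2 := le_self_pow₀ hs1 two_ne_zero
  have h4 : 1 + |Real.log c| ≤ s ^ 2 * (s ^ 2 - b - d) := by
    calc 1 + |Real.log c| ≤ 1 * (s ^ 2 - b - d) := by linarith
      _ ≤ _ := by
        gcongr
        · linarith
        · linarith
  have h5 := neg_abs_le (Real.log c)
  nlinarith

end Quartic


/-! ### Weak convergence and the limit law -/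

theorem measureReal_Ioc_eq_cdf_sub (P : Measure ℝ) [IsProbabilityMeasure P] {a b : ℝ}
    (hab : a ≤ b) : P.real (Ioc a b) = cdf P b - cdf P a := by
  rw [cdf_eq_real, cdf_eq_real, ← Iic_sdiff_Iic,
    measureReal_sdiff (Iic_subset_Iic.2 hab) measurableSet_Iic]

/-- Pointwise convergence of the distribution functions implies weak convergence. -/
theorem tendsto_probabilityMeasure_of_tendsto_cdf {P : ℕ → ProbabilityMeasure ℝ}
    {Q : ProbabilityMeasure ℝ}
    (h : ∀ t, Tendsto (fun N => cdf (P N : Measure ℝ) t) atTop (𝓝 (cdf (Q : Measure ℝ) t))) :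
    Tendsto P atTop (𝓝 Q) := by
  -- Half-open intervals form a π-system containing small neighbourhoods of every point; their
  -- masses are differences of distribution functions, assumed to converge at every t.
  refine (isPiSystem_Ioc (id : ℝ → ℝ) id).tendsto_probabilityMeasure_of_tendsto_of_mem ?_ ?_ ?_
  · rintro _ ⟨a, b, -, rfl⟩
    exact measurableSet_Ioc
  · intro u hu x hx
    obtain ⟨ε, hε, hball⟩ := Metric.isOpen_iff.1 hu x hx
    refine ⟨Ioc (x - ε / 2) (x + ε / 2), ⟨x - ε / 2, x + ε / 2, ?_, rfl⟩,
      Ioc_mem_nhds (by linarith) (by linarith), fun y hy => hball ?_⟩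
    · simp only [id]
      linarith
    · rw [Metric.mem_ball, Real.dist_eq, abs_lt]
      constructor <;> linarith [hy.1, hy.2]
  · rintro _ ⟨a, b, hab, rfl⟩
    rw [← NNReal.tendsto_coe]
    have e : ∀ R : ProbabilityMeasure ℝ, ((R (Ioc a b) : NNReal) : ℝ)
        = cdf (R : Measure ℝ) b - cdf (R : Measure ℝ) a := fun R =>
      measureReal_Ioc_eq_cdf_sub (R : Measure ℝ) (le_of_lt hab)
    simp only [id, e]
    exact (h b).sub (h a)

theorem law_real_eq_sum (p N : ℕ) (β h : ℝ) (s : Set (Config N)) :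
    (law p N β h).real s = ∑ x : Config N, pmf p N β h x * s.indicator 1 x := by
  have hs : MeasurableSet s := MeasurableSet.of_discrete
  rw [measureReal_def, law]
  simp only [Measure.finsetSum_apply, Measure.smul_apply, smul_eq_mul]
  rw [ENNReal.toReal_sum fun x _ => ENNReal.mul_ne_top ENNReal.ofReal_ne_top (measure_ne_top _ _)]
  refine Finset.sum_congr rfl fun x _ => ?_
  rw [ENNReal.toReal_mul, ENNReal.toReal_ofReal (pmf_nonneg p N β h x), Measure.dirac_apply' _ hs]
  by_cases hx : x ∈ s <;> simp [hx]

section Limit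

variable {p : ℕ} {β h m : ℝ}

/-- The distribution functions of the fluctuations converge, also along convergent arguments. -/
theorem tendsto_law_fluct_le (hp : 3 ≤ p) (hm : IsUniqueGlobalMax p β h m)
    (h2 : iteratedDeriv 2 (H p β h) m = 0) {a : ℕ → ℝ} {b : ℝ} (ha : Tendsto a atTop (𝓝 b)) :
    Tendsto (fun N => (law p N β h).real {x | fluct m x ≤ a N}) atTop
      (𝓝 (cdf (quarticMeasure (iteratedDeriv 4 (H p β h) m / 24) 0) b)) := by
  have hq : iteratedDeriv 4 (H p β h) m / 24 < 0 := by
    linarith [hm.iteratedDeriv_four_neg hp h2]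
  have := isProbabilityMeasure_quarticMeasure hq 0
  have hlim := tendsto_sum_pmf_mul hp hm h2 (fun N => (Iic (a N)).indicator 1)
    ((Iic b).indicator 1) 0 (fun N w => ?_) ?_
  · rw [cdf_eq_real, measureReal_quarticMeasure _ _ measurableSet_Iic]
    simp only [zero_mul, Real.exp_zero, one_mul]
    refine hlim.congr fun N => ?_
    rw [law_real_eq_sum]
    rfl
  · by_cases hw : w ∈ Iic (a N) <;> simp [hw]
  · have hae : ∀ᵐ y : ℝ, y ≠ b := by
      rw [ae_iff]
      simp
    filter_upwards [hae] with y hy w hw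
    rcases lt_or_gt_of_ne hy with hlt | hgt
    · have hev : ∀ᶠ N in atTop, w N < a N := hw.eventually_lt ha hlt
      rw [indicator_of_mem (show y ∈ Iic b from hlt.le)]
      refine tendsto_const_nhds.congr' (hev.mono fun N hN => ?_)
      exact (indicator_of_mem (show w N ∈ Iic (a N) from hN.le) (1 : ℝ → ℝ)).symm
    · have hev : ∀ᶠ N in atTop, a N < w N := ha.eventually_lt hw hgt
      rw [indicator_of_notMem (show y ∉ Iic b from not_le.2 hgt)]
      refine tendsto_const_nhds.congr' (hev.mono fun N hN => ?_)
      exact (indicator_of_notMem (show w N ∉ Iic (a N) from not_le.2 hN) _).symm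

/-- Constant configurations are asymptotically negligible. -/
theorem tendsto_law_constant (hp : 3 ≤ p) (hm : IsUniqueGlobalMax p β h m)
    (h2 : iteratedDeriv 2 (H p β h) m = 0) :
    Tendsto (fun N => (law p N β h).real {x : Config N | (N : ℝ) ≤ |mag x|}) atTop (𝓝 0) := by
  have hδ : 0 < 1 - |m| := by
    have := abs_lt.2 hm.1
    linarith
  -- If |mag| ≥ N then |mag/N - m| ≥ 1 - |m|, so W lies in this set, which escapes to infinity.
  let S : ℕ → Set ℝ := fun N => {w | (1 - |m|) * (N : ℝ) ^ (1 / 4 : ℝ) ≤ |w|}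
  have hlim := tendsto_sum_pmf_mul hp hm h2 (fun N => (S N).indicator 1) (fun _ => 0) 0
    (fun N w => ?_) (Eventually.of_forall fun y w hw => ?_)
  · simp only [zero_mul, integral_zero, zero_div] at hlim
    refine squeeze_zero' (Eventually.of_forall fun N => measureReal_nonneg) ?_ hlim
    filter_upwards [eventually_gt_atTop 0] with N hN
    have hN0 : (0 : ℝ) < N := by exact_mod_cast hN
    rw [law_real_eq_sum]
    refine Finset.sum_le_sum fun x _ => mul_le_mul_of_nonneg_left ?_ (pmf_nonneg p N β h x)
    by_cases hx : (N : ℝ) ≤ |mag x|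
    · rw [indicator_of_mem (show x ∈ {x : Config N | (N : ℝ) ≤ |mag x|} from hx),
        indicator_of_mem]
      · rfl
      · change _ ≤ |fluct m x|
        have h1 : 1 ≤ |mag x / N| := by
          rw [abs_div, abs_of_pos hN0, le_div_iff₀ hN0, one_mul]
          exact hx
        have h3 := abs_sub_abs_le_abs_sub (mag x / N) m
        rw [fluct, abs_mul, abs_of_nonneg (by positivity : 0 ≤ (N : ℝ) ^ (1 / 4 : ℝ)), mul_comm]
        gcongr
        linarith
    · rw [indicator_of_notMem (show x ∉ {x : Config N | (N : ℝ) ≤ |mag x|} from hx)]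
      exact indicator_nonneg (fun _ _ => zero_le_one) _
  · by_cases hw : w ∈ S N <;> simp [hw]
  · have htop : Tendsto (fun N : ℕ => (1 - |m|) * (N : ℝ) ^ (1 / 4 : ℝ)) atTop atTop :=
      ((tendsto_rpow_atTop (by norm_num)).comp tendsto_natCast_atTop_atTop).const_mul_atTop hδ
    have hev : ∀ᶠ N in atTop, |w N| < (1 - |m|) * (N : ℝ) ^ (1 / 4 : ℝ) := by
      filter_upwards [hw.abs.eventually (gt_mem_nhds (lt_add_one |y|)),
        htop.eventually_ge_atTop (|y| + 1)] with N h1 h3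
      linarith
    refine tendsto_const_nhds.congr' (hev.mono fun N hN => ?_)
    exact (indicator_of_notMem (show w N ∉ S N from not_le.2 hN) _).symm

theorem abs_measureReal_sub_le {Ω : Type*} [MeasurableSpace Ω] (P : Measure Ω)
    [IsProbabilityMeasure P] {A B C : Set Ω} (h : ∀ x, x ∉ C → (x ∈ A ↔ x ∈ B)) :
    |P.real A - P.real B| ≤ P.real C := by
  have key : ∀ A B : Set Ω, (∀ x, x ∉ C → (x ∈ A ↔ x ∈ B)) → P.real A ≤ P.real B + P.real C := by
    intro A B h
    refine (measureReal_mono fun x hx => ?_).trans (measureReal_union_le B C)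
    by_cases hC : x ∈ C
    · exact Or.inr hC
    · exact Or.inl ((h x hC).1 hx)
  rw [abs_le]
  constructor
  · linarith [key B A fun x hx => (h x hx).symm]
  · linarith [key A B h]

/-- Off the constant configurations the event is W ≤ E_θ W with θ = h + t N^(-3/4). The right side
converges to the mean of the quartic law tilted by t, and the exceptional configurations have
vanishing probability. -/
theorem tendsto_law_scaled_le (hp : 3 ≤ p) (hm : IsUniqueGlobalMax p β h m)
    (h2 : iteratedDeriv 2 (H p β h) m = 0) {est : (N : ℕ) → Config N → ℝ}
    (hest : ∀ N, IsFieldMLE p N β (est N)) (t : ℝ) :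
    Tendsto (fun N : ℕ => (law p N β h).real {x | (N : ℝ) ^ (3 / 4 : ℝ) * (est N x - h) ≤ t}) atTop
      (𝓝 (cdf (quarticMeasure (iteratedDeriv 4 (H p β h) m / 24) 0)
        (∫ u, u ∂(quarticMeasure (iteratedDeriv 4 (H p β h) m / 24) t)))) := by
  have hmean := tendsto_sum_pmf_tilt_fluct hp hm h2 t
  simp only [mul_assoc] at hmean
  rw [← integral_quarticMeasure (iteratedDeriv 4 (H p β h) m / 24) t fun y => y] at hmean
  have hcdf := tendsto_law_fluct_le hp hm h2 hmean
  refine hcdf.congr_dist ?_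
  refine squeeze_zero (fun N => dist_nonneg) (fun N => ?_) (tendsto_law_constant hp hm h2)
  rw [Real.dist_eq]
  refine abs_measureReal_sub_le _ fun x hx => ?_
  exact ((hest N).scaled_le_iff (not_le.1 hx) h m t).symm

end Limit

end CurieWeiss
end

theorem theorem2p3 (p : ℕ) (hp : 3 ≤ p) (β h : ℝ) (hβ : 0 ≤ β)
    (hspecial : CurieWeiss.IsSpecial p β h)
    (m : ℝ) (hm : CurieWeiss.IsUniqueGlobalMax p β h m)
    (hHat : (N : ℕ) → CurieWeiss.Config N → ℝ)
    (hMLE : ∀ N : ℕ, CurieWeiss.IsFieldMLE p N β (hHat N)) :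
    -- the laws `F_{0,t}` are well-defined probability laws with a finite mean
    (∀ t : ℝ, Integrable (CurieWeiss.quarticWeight p β h m 0 t) volume ∧
      IsProbabilityMeasure (CurieWeiss.quarticLaw p β h m 0 t) ∧
      Integrable (fun u : ℝ => u) (CurieWeiss.quarticLaw p β h m 0 t)) ∧
    ∃ (G₁ : Measure ℝ) (_ : IsProbabilityMeasure G₁),
      (∀ t : ℝ, cdf G₁ t =
        cdf (CurieWeiss.quarticLaw p β h m 0 0)
          (∫ u, u ∂(CurieWeiss.quarticLaw p β h m 0 t))) ∧
      (∀ (μ : ℝ) (v : NNReal), G₁ ≠ gaussianReal μ v) ∧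
      TendstoInDistribution
        (fun (N : ℕ) (x : CurieWeiss.Config N) => (N : ℝ) ^ (3 / 4 : ℝ) * (hHat N x - h))
        atTop (fun y : ℝ => y) (fun N : ℕ => CurieWeiss.law p N β h) G₁ := by
  open CurieWeiss in
  have h2 : iteratedDeriv 2 (H p β h) m = 0 := by
    obtain ⟨m', hm', h2⟩ := hspecial
    rwa [hm.eq hm'] at h2
  have hq : iteratedDeriv 4 (H p β h) m / 24 < 0 := by
    linarith [hm.iteratedDeriv_four_neg hp h2]
  have hprob := isProbabilityMeasure_quarticMeasure hq 0
  have hatom := nullSingletonClass_quarticMeasure (iteratedDeriv 4 (H p β h) m / 24) 0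
  simp only [quarticLaw_zero_eq]
  refine ⟨fun t => ⟨?_, isProbabilityMeasure_quarticMeasure hq t,
    integrable_id_quarticMeasure hq t⟩, ?_⟩
  · refine (integrable_exp_quartic hq t).congr (Eventually.of_forall fun x => ?_)
    simp [quarticWeight]
  obtain ⟨G, hGprob, hG⟩ := exists_measure_tiltedMeanCdf
    (volume_absolutelyContinuous_quarticMeasure hq 0) (integrable_exp_mul_quarticMeasure hq)
  have hG' : ∀ t, cdf G t = cdf (quarticMeasure (iteratedDeriv 4 (H p β h) m / 24) 0)
      (∫ u, u ∂(quarticMeasure (iteratedDeriv 4 (H p β h) m / 24) t)) := fun t => by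
    rw [hG, integral_id_quarticMeasure hq]
  refine ⟨G, hGprob, hG', ne_gaussianReal_of_cdf_eq hq hG,
    ⟨fun N => Measurable.aemeasurable .of_discrete, aemeasurable_id, ?_⟩⟩
  refine tendsto_probabilityMeasure_of_tendsto_cdf fun t => ?_
  have hlim := tendsto_law_scaled_le hp hm h2 hMLE t
  rw [← hG'] at hlim
  simp only [ProbabilityMeasure.coe_mk, Measure.map_id']
  refine hlim.congr fun N => ?_
  have : IsProbabilityMeasure ((law p N β h).map
      fun x => (N : ℝ) ^ (3 / 4 : ℝ) * (hHat N x - h)) :=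
    Measure.isProbabilityMeasure_map (Measurable.aemeasurable .of_discrete)
  rw [cdf_eq_real, map_measureReal_apply .of_discrete measurableSet_Iic]
  rfl
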